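/- Let $M_k$ be the complex $k\times k$ matrices with inner product $\langle C,D\rangle=\operatorname{tr}(CD^*)$, and identify $M_k\otimes M_m$ with $M_{km}$ via the Kronecker product. A matrix $A\in M_k\otimes M_m$ is - *PPT* if $A$ and its partial transpose $A^{t_1}$ (the image of $A$ under the linear map $C\otimes D\mapsto C^t\otimes D$) are positive semidefinite Hermitian; - *separable* if $A=\sum_{i} C_i\otimes D_i$ (a finite sum) with all $C_i\in M_k$, $D_i\in M_m$ positive semidefinite Hermitian; - *weak irreducible* if it is positive semidefinite Hermitian and, for all Hermitian projections $V_1,V_2\in M_k$ and $W_1,W_2\in M_m$ with $V_1V_2=0$, $W_1W_2=0$, $V_1+V_2=\mathrm{Id}$, $W_1+W_2=\mathrm{Id}$, the equality $A=\sum_{i=1}^2 (V_i\otimes W_i)A(V_i\otimes W_i)$ implies $(V_1\otimes W_1)A(V_1\otimes W_1)=0$ or $(V_2\otimes W_2)A(V_2\otimes W_2)=0$. A *Hermitian Schmidt decomposition* of $A$ is $A=\sum_{i=1}^n\lambda_i\gamma_i\otimes\delta_i$ with real $\lambda_i>0$ and Hermitian $\gamma_i\in M_k$, $\delta_i\in M_m$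 such that $(\gamma_i)_i$ and $(\delta_i)_i$ are orthonormal families. **Theorem.** (a) Let $A\in M_k\otimes M_m$ be a weak irreducible PPT matrix with a Hermitian Schmidt decomposition $\sum_{i=1}^n\lambda_i\gamma_i\otimes\delta_i$, where $n\ge1$ and $\lambda_1\ge\dots\ge\lambda_n>0$. Let $\mu$ be the least positive eigenvalue of $\gamma_1\otimes\delta_1$. If $$\frac{\lambda_1\mu}{\lambda_2+\dots+\lambda_n}\ge 1,\qquad\text{i.e. } \lambda_1\mu\ge\lambda_2+\dots+\lambda_n$$ (automatically satisfied when $n=1$), then $A$ is separable. (b) The constant $1$ in (a) cannot be replaced by any $l$ with $0<l<1$: for every such $l$ there are $k,m$, a weak irreducible PPT matrix $A\in M_k\otimes M_m$ and a Hermitian Schmidt decomposition of $A$ as in (a), with $\mu$ as in (a), such that $\frac{\lambda_1\mu}{\lambda_2+\dots+\lambda_n}\ge l$ (the denominator being nonzero) and $A$ is not separable. (c) For $n\ge 1$ let $\gamma_1=\frac{1}{\sqrt{n+1}}\mathrm{Id}\in M_{n+1}$ and $\gamma_2=\frac1{\sqrt{n^2+n}}\operatorname{diag}(n,-1,\dots,-1)\in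 M_{n+1}$. The least positive eigenvalue of $\gamma_1\otimes\gamma_1$ is $\mu=\frac1{n+1}$. For all $\lambda_1,\lambda_2>0$, the expression $A(n)=\lambda_1\gamma_1\otimes\gamma_1+\lambda_2\gamma_2\otimes(-\gamma_2)$ is a Hermitian Schmidt decomposition, and $A(n)$ is separable if and only if $\frac{\lambda_1\mu}{\lambda_2}\ge\frac{n^2}{n^2+n}$. For every $l$ with $0<l<1$ there is $n\ge1$ with $\frac{n^2}{n^2+n}>l$. -/

import Mathlib

open scoped Kronecker ComplexOrder

noncomputable section

/-- Elements of `M_k ⊗ M_m`, identified with `km × km` complex matrices via the Kronecker product. -/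
abbrev BipartiteMatrix (k m : ℕ) : Type := Matrix (Fin k × Fin m) (Fin k × Fin m) ℂ

/-- The partial transposition `A ↦ A^{t₁}` on the first factor: the linear map with
`C ⊗ D ↦ Cᵗ ⊗ D`. -/
def partialTranspose {k m : ℕ} (A : BipartiteMatrix k m) : BipartiteMatrix k m :=
  Matrix.of fun p q => A (q.1, p.2) (p.1, q.2)

theorem partialTranspose_kronecker {k m : ℕ} (C : Matrix (Fin k) (Fin k) ℂ)
    (D : Matrix (Fin m) (Fin m) ℂ) :
    partialTranspose (C ⊗ₖ D) = C.transpose ⊗ₖ D := by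
  ext p q
  simp [partialTranspose, Matrix.kroneckerMap_apply]

/-- Positive under partial transposition (`A` itself is positive semidefinite Hermitian too). -/
def IsPPT {k m : ℕ} (A : BipartiteMatrix k m) : Prop :=
  A.PosSemidef ∧ (partialTranspose A).PosSemidef

/-- A separable matrix: a finite sum of Kronecker products of positive semidefinite Hermitian
matrices. -/
def IsSeparableMatrix {k m : ℕ} (A : BipartiteMatrix k m) : Prop :=
  ∃ (n : ℕ) (C : Fin n → Matrix (Fin k) (Fin k) ℂ) (D : Fin n → Matrix (Fin m) (Fin m) ℂ),
    (∀ i, (C i).PosSemidef) ∧ (∀ i, (D i).PosSemidef) ∧ A = ∑ i, C i ⊗ₖ D i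

/-- Weak irreducibility of a positive semidefinite Hermitian matrix. -/
def IsWeakIrreducible {k m : ℕ} (A : BipartiteMatrix k m) : Prop :=
  A.PosSemidef ∧
  ∀ (V₁ V₂ : Matrix (Fin k) (Fin k) ℂ) (W₁ W₂ : Matrix (Fin m) (Fin m) ℂ),
    (V₁.IsHermitian ∧ V₁ * V₁ = V₁) → (V₂.IsHermitian ∧ V₂ * V₂ = V₂) →
    (W₁.IsHermitian ∧ W₁ * W₁ = W₁) → (W₂.IsHermitian ∧ W₂ * W₂ = W₂) →
    V₁ * V₂ = 0 → W₁ * W₂ = 0 → V₁ + V₂ = 1 → W₁ + W₂ = 1 →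
    A = (V₁ ⊗ₖ W₁) * A * (V₁ ⊗ₖ W₁) + (V₂ ⊗ₖ W₂) * A * (V₂ ⊗ₖ W₂) →
    (V₁ ⊗ₖ W₁) * A * (V₁ ⊗ₖ W₁) = 0 ∨ (V₂ ⊗ₖ W₂) * A * (V₂ ⊗ₖ W₂) = 0

/-- Orthonormality of a family of matrices for the inner product `⟨C, D⟩ = tr (C D*)`. -/
def IsOrthonormalFamily {k n : ℕ} (γ : Fin n → Matrix (Fin k) (Fin k) ℂ) : Prop :=
  ∀ i j, (γ i * (γ j).conjTranspose).trace = if i = j then 1 else 0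

/-- `A = ∑ λᵢ γᵢ ⊗ δᵢ` is a Hermitian Schmidt decomposition of `A`. -/
structure IsHermitianSchmidtDecomposition {k m n : ℕ} (A : BipartiteMatrix k m)
    (lam : Fin n → ℝ) (γ : Fin n → Matrix (Fin k) (Fin k) ℂ)
    (δ : Fin n → Matrix (Fin m) (Fin m) ℂ) : Prop where
  lam_pos : ∀ i, 0 < lam i
  hermitian_left : ∀ i, (γ i).IsHermitian
  hermitian_right : ∀ i, (δ i).IsHermitian
  orthonormal_left : IsOrthonormalFamily γ
  orthonormal_right : IsOrthonormalFamily δ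
  eq_sum : A = ∑ i, (lam i : ℂ) • (γ i ⊗ₖ δ i)

/-- `μ` is the least positive eigenvalue of `M`. -/
def IsLeastPositiveEigenvalue {k m : ℕ} (M : BipartiteMatrix k m) (μ : ℝ) : Prop :=
  IsLeast {x : ℝ | 0 < x ∧ Module.End.HasEigenvalue (Matrix.toLin' M) (x : ℂ)} μ

/-- The normalized identity matrix of order `n + 1`. -/
def normalizedOne (n : ℕ) : Matrix (Fin (n + 1)) (Fin (n + 1)) ℂ :=
  Matrix.diagonal fun _ => ((1 / Real.sqrt (n + 1) : ℝ) : ℂ)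

/-- The traceless matrix `diag (n, -1, …, -1) / √(n² + n)` of order `n + 1`. -/
def tracelessDiag (n : ℕ) : Matrix (Fin (n + 1)) (Fin (n + 1)) ℂ :=
  Matrix.diagonal fun i =>
    (((if i = 0 then (n : ℝ) else -1) / Real.sqrt ((n : ℝ) ^ 2 + n) : ℝ) : ℂ)

/-- The matrix `λ₁ γ₁ ⊗ γ₁ + λ₂ γ₂ ⊗ (-γ₂)` with `γ₁ = normalizedOne n`, `γ₂ = tracelessDiag n`. -/
def diagFamily (n : ℕ) (lam₁ lam₂ : ℝ) : BipartiteMatrix (n + 1) (n + 1) :=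
  (lam₁ : ℂ) • (normalizedOne n ⊗ₖ normalizedOne n) +
    (lam₂ : ℂ) • (tracelessDiag n ⊗ₖ (-tracelessDiag n))

end

/-!
For (a), let `A = ∑ λᵢ γᵢ ⊗ δᵢ` be weak irreducible and PPT. A Perron–Frobenius argument shows that
`γ₁ ⊗ δ₁` may be taken positive semidefinite, and weak irreducibility forces `A` to live on its
range. There `γ₁ ⊗ δ₁ ≥ μ`, so `λ₁ γ₁ ⊗ δ₁ - (∑_{i ≥ 2} λᵢ) (P ⊗ Q)` is separable for the range
projections `P`, `Q`, and each `P ⊗ Q + γᵢ ⊗ δᵢ` is separable as well, since `‖γᵢ‖, ‖δᵢ‖ ≤ 1`.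

For (b), a separable matrix satisfies coupled Cauchy–Schwarz bounds in which the product
`(x₀ y₀) (x₁ y₁) = (x₀ y₁) (x₁ y₀)` of vector entries is read in two ways. A small perturbation of
`1 - E₀₀ ⊗ E₀₀` violates them while having no product vector in its kernel, which makes it weak
irreducible; its coefficients `λ₁, …, λ₇` satisfy `λ₁ μ = 1` and `λ₂ + … + λ₇ → 1`.
-/

section Kronecker

variable {R ι κ : Type*}

theorem sub_kronecker [NonUnitalNonAssocRing R] (X X' : Matrix ι ι R) (Y : Matrix κ κ R) :
    (X - X') ⊗ₖ Y = X ⊗ₖ Y - X' ⊗ₖ Y :=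
  Matrix.ext fun _ _ => sub_mul _ _ _

theorem kronecker_sub [NonUnitalNonAssocRing R] (X : Matrix ι ι R) (Y Y' : Matrix κ κ R) :
    X ⊗ₖ (Y - Y') = X ⊗ₖ Y - X ⊗ₖ Y' :=
  Matrix.ext fun _ _ => mul_sub _ _ _

theorem neg_kronecker_neg [NonUnitalNonAssocRing R] (X : Matrix ι ι R) (Y : Matrix κ κ R) :
    (-X) ⊗ₖ (-Y) = X ⊗ₖ Y :=
  Matrix.ext fun _ _ => neg_mul_neg _ _

variable [Fintype ι] [Fintype κ]

theorem hasEigenvalue_kronecker [Field R] [DecidableEq ι] [DecidableEq κ] {X : Matrix ι ι R}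
    {Y : Matrix κ κ R} {a b : R}
    (ha : Module.End.HasEigenvalue X.toLin' a) (hb : Module.End.HasEigenvalue Y.toLin' b) :
    Module.End.HasEigenvalue (X ⊗ₖ Y).toLin' (a * b) := by
  obtain ⟨v, hv, hv0⟩ := ha.exists_hasEigenvector
  obtain ⟨w, hw, hw0⟩ := hb.exists_hasEigenvector
  rw [Module.End.mem_eigenspace_iff, Matrix.toLin'_apply] at hv hw
  obtain ⟨i, hi⟩ := Function.ne_iff.mp hv0
  obtain ⟨j, hj⟩ := Function.ne_iff.mp hw0
  refine Module.End.hasEigenvalue_of_hasEigenvector (x := fun p => v p.1 * w p.2)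
    ⟨Module.End.mem_eigenspace_iff.mpr ?_, Function.ne_iff.mpr ⟨(i, j), mul_ne_zero hi hj⟩⟩
  ext ⟨i, j⟩
  calc ((X ⊗ₖ Y).mulVec fun p => v p.1 * w p.2) (i, j)
      = X.mulVec v i * Y.mulVec w j := by
        simp only [Matrix.mulVec, dotProduct, Matrix.kroneckerMap_apply, Fintype.sum_prod_type,
          Finset.sum_mul_sum, mul_mul_mul_comm]
    _ = a * b * (v i * w j) := by
        rw [hv, hw, Pi.smul_apply, Pi.smul_apply, smul_eq_mul, smul_eq_mul, mul_mul_mul_comm]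

end Kronecker

section PosSemidef

open scoped MatrixOrder

variable {𝕜 ι κ : Type*} [RCLike 𝕜]

theorem isHermitian_kronecker {X : Matrix ι ι 𝕜} {Y : Matrix κ κ 𝕜} (hX : X.IsHermitian)
    (hY : Y.IsHermitian) : (X ⊗ₖ Y).IsHermitian := by
  rw [Matrix.IsHermitian, Matrix.conjTranspose_kronecker, hX.eq, hY.eq]

variable [Fintype ι] [Fintype κ]

theorem isStarProjection_kronecker {V : Matrix ι ι 𝕜} {W : Matrix κ κ 𝕜}
    (hV : IsStarProjection V) (hW : IsStarProjection W) : IsStarProjection (V ⊗ₖ W) :=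
  ⟨by rw [IsIdempotentElem, ← Matrix.mul_kronecker_mul, hV.isIdempotentElem.eq,
      hW.isIdempotentElem.eq], isHermitian_kronecker hV.isSelfAdjoint hW.isSelfAdjoint⟩

theorem trace_mul_nonneg {A C : Matrix ι ι 𝕜} (hA : A.PosSemidef) (hC : C.PosSemidef) :
    0 ≤ (A * C).trace := by
  classical
  obtain ⟨B, rfl⟩ := CStarAlgebra.nonneg_iff_eq_star_mul_self.mp hA.nonneg
  rw [Matrix.mul_assoc, Matrix.trace_mul_comm]
  exact (hC.mul_mul_conjTranspose_same B).trace_nonneg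

theorem mul_eq_zero_of_trace_mul_eq_zero {A C : Matrix ι ι 𝕜} (hA : A.PosSemidef)
    (hC : C.PosSemidef) (h : (A * C).trace = 0) : A * C = 0 := by
  classical
  obtain ⟨B, rfl⟩ := CStarAlgebra.nonneg_iff_eq_star_mul_self.mp hA.nonneg
  obtain ⟨D, rfl⟩ := CStarAlgebra.nonneg_iff_eq_mul_star_self.mp hC.nonneg
  have hBD : B * D = 0 := by
    rw [← Matrix.trace_mul_conjTranspose_self_eq_zero_iff, ← h, Matrix.conjTranspose_mul,
      Matrix.trace_mul_comm (_ * _)]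
    simp only [Matrix.mul_assoc, Matrix.star_eq_conjTranspose]
    rw [Matrix.trace_mul_comm]
    simp only [Matrix.mul_assoc]
  calc star B * B * (D * star D) = star B * (B * D) * star D := by simp only [Matrix.mul_assoc]
    _ = 0 := by rw [hBD, Matrix.mul_zero, Matrix.zero_mul]

theorem posSemidef_of_isStarProjection {P : Matrix ι ι 𝕜} (hP : IsStarProjection P) :
    P.PosSemidef :=
  Matrix.nonneg_iff_posSemidef.mp hP.nonneg

theorem mul_eq_zero_of_mul_mul_eq_zero {A P : Matrix ι ι 𝕜} (hA : A.PosSemidef)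
    (hP : IsStarProjection P) (h : P * A * P = 0) : A * P = 0 :=
  mul_eq_zero_of_trace_mul_eq_zero hA (posSemidef_of_isStarProjection hP) <| by
    rw [← hP.isIdempotentElem.eq, ← Matrix.mul_assoc, Matrix.trace_mul_comm, ← Matrix.mul_assoc,
      h, Matrix.trace_zero]

theorem exists_posSemidef_eq_sub {X : Matrix ι ι 𝕜} (hX : X.IsHermitian) :
    ∃ P N : Matrix ι ι 𝕜, P.PosSemidef ∧ N.PosSemidef ∧ P * N = 0 ∧ X = P - N := by
  classical
  exact ⟨X⁺, X⁻, Matrix.nonneg_iff_posSemidef.mp (CFC.posPart_nonneg X),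
    Matrix.nonneg_iff_posSemidef.mp (CFC.negPart_nonneg X), CFC.posPart_mul_negPart X,
    (CFC.posPart_sub_negPart X hX.isSelfAdjoint).symm⟩

variable [DecidableEq ι] {X Y : Matrix ι ι 𝕜}

theorem posSemidef_trace_smul_one_sub (hY : Y.PosSemidef) : (Y.trace • 1 - Y).PosSemidef := by
  rw [hY.isHermitian.trace_eq_sum_eigenvalues, ← RCLike.ofReal_sum, ← Matrix.le_iff]
  have h : Y ≤ algebraMap ℝ (Matrix ι ι 𝕜) (∑ i, hY.isHermitian.eigenvalues i) := by
    refine le_algebraMap_of_spectrum_le fun x hx => ?_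
    obtain ⟨i, rfl⟩ := hY.isHermitian.spectrum_real_eq_range_eigenvalues ▸ hx
    exact Finset.single_le_sum (fun j _ => hY.eigenvalues_nonneg j) (Finset.mem_univ i)
  rwa [Algebra.algebraMap_eq_smul_one, RCLike.real_smul_eq_coe_smul (K := 𝕜)] at h

theorem posSemidef_one_sub_of_trace_mul_self (hX : X.IsHermitian) (h : (X * X).trace = 1) :
    (1 - X).PosSemidef := by
  have hsq (Z : Matrix ι ι 𝕜) (hZ : Z.IsHermitian) : (Z * Z).PosSemidef := by
    simpa only [hZ.eq] using Matrix.posSemidef_conjTranspose_mul_self Z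
  have h1 := posSemidef_trace_smul_one_sub (hsq X hX)
  rw [h, one_smul] at h1
  have h2 := hsq (1 - X) (Matrix.isHermitian_one.sub hX)
  have h3 : 1 - X = (2⁻¹ : ℝ) • ((1 - X * X) + (1 - X) * (1 - X)) := by
    rw [eq_inv_smul_iff₀ two_ne_zero, two_smul]
    noncomm_ring
  rw [h3]
  exact (h1.add h2).smul (by norm_num)

/-- The orthogonal projection onto the range of a Hermitian matrix. Since `0⁻¹ = 0`, the function
`x ↦ x * x⁻¹` is the indicator function of the nonzero reals. -/
noncomputable def supportProjection (X : Matrix ι ι 𝕜) : Matrix ι ι 𝕜 :=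
  cfc (fun x : ℝ => x * x⁻¹) X

theorem cfc_mul_cfc (f g : ℝ → ℝ) (X : Matrix ι ι 𝕜) :
    cfc f X * cfc g X = cfc (fun x => f x * g x) X :=
  (cfc_mul f g X (X.finite_real_spectrum.continuousOn f)
    (X.finite_real_spectrum.continuousOn g)).symm

theorem isStarProjection_supportProjection (X : Matrix ι ι 𝕜) :
    IsStarProjection (supportProjection X) := by
  refine ⟨?_, cfc_predicate _ X⟩
  rw [IsIdempotentElem, supportProjection, cfc_mul_cfc]
  simp only [← mul_assoc, mul_inv_mul_cancel]

theorem supportProjection_eq_mul_cfc_inv (hX : X.IsHermitian) :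
    supportProjection X = X * cfc (fun x : ℝ => x⁻¹) X :=
  calc supportProjection X = cfc (fun x : ℝ => x) X * cfc (fun x : ℝ => x⁻¹) X :=
        (cfc_mul_cfc _ _ X).symm
    _ = X * cfc (fun x : ℝ => x⁻¹) X := by rw [cfc_id' ℝ X hX.isSelfAdjoint]

theorem supportProjection_eq_cfc_inv_mul (hX : X.IsHermitian) :
    supportProjection X = cfc (fun x : ℝ => x⁻¹) X * X := by
  have h := congrArg star (supportProjection_eq_mul_cfc_inv hX)
  rwa [star_mul, (isStarProjection_supportProjection X).isSelfAdjoint.star_eq,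
    (cfc_predicate _ X : IsSelfAdjoint _).star_eq, hX.isSelfAdjoint.star_eq] at h

theorem supportProjection_mul (hX : X.IsHermitian) : supportProjection X * X = X :=
  calc supportProjection X * X
      = cfc (fun x : ℝ => x * x⁻¹) X * cfc (fun x : ℝ => x) X := by
        rw [cfc_id' ℝ X hX.isSelfAdjoint, supportProjection]
    _ = cfc (fun x : ℝ => x) X := by simp only [cfc_mul_cfc, mul_inv_mul_cancel]
    _ = X := cfc_id' ℝ X hX.isSelfAdjoint

theorem mul_supportProjection (hX : X.IsHermitian) : X * supportProjection X = X := by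
  have h := congrArg star (supportProjection_mul hX)
  rwa [star_mul, (isStarProjection_supportProjection X).isSelfAdjoint.star_eq,
    hX.isSelfAdjoint.star_eq] at h

theorem supportProjection_mul_eq_zero {Z : Matrix ι ι 𝕜} (hX : X.IsHermitian) (h : X * Z = 0) :
    supportProjection X * Z = 0 := by
  rw [supportProjection_eq_cfc_inv_mul hX, Matrix.mul_assoc, h, Matrix.mul_zero]

theorem exists_pos_mem_spectrum (hX : X.PosSemidef) (hX0 : X ≠ 0) :
    ∃ x ∈ spectrum ℝ X, 0 < x := by
  by_contra! h
  have h0 (x) (hx : x ∈ spectrum ℝ X) : x = 0 :=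
    le_antisymm (h x hx) (spectrum_nonneg_of_nonneg hX.nonneg hx)
  refine hX0 ?_
  rw [← cfc_id' ℝ X hX.isHermitian.isSelfAdjoint, cfc_congr h0, cfc_const_zero]

theorem exists_hasEigenvalue_posSemidef_sub_smul_supportProjection (hX : X.PosSemidef)
    (hX0 : X ≠ 0) : ∃ c : ℝ, 0 < c ∧ Module.End.HasEigenvalue X.toLin' (c : 𝕜) ∧
      (X - (c : 𝕜) • supportProjection X).PosSemidef := by
  obtain ⟨x, hx, hx0⟩ := exists_pos_mem_spectrum hX hX0
  obtain ⟨c, ⟨hc, hc0 : 0 < c⟩, hmin⟩ := Set.exists_min_image (spectrum ℝ X ∩ Set.Ioi 0) id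
    (X.finite_real_spectrum.subset Set.inter_subset_left) ⟨x, hx, hx0⟩
  refine ⟨c, hc0, ?_, ?_⟩
  · rw [Module.End.hasEigenvalue_iff_mem_spectrum, Matrix.spectrum_toLin']
    exact (spectrum.algebraMap_mem_iff 𝕜).mpr hc
  have hsub : X - (c : 𝕜) • supportProjection X = cfc (fun x : ℝ => x - c * (x * x⁻¹)) X := by
    rw [cfc_sub _ _ X (X.finite_real_spectrum.continuousOn _)
      (X.finite_real_spectrum.continuousOn _), cfc_const_mul _ _ X
      (X.finite_real_spectrum.continuousOn _), cfc_id' ℝ X hX.isHermitian.isSelfAdjoint,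
      RCLike.real_smul_eq_coe_smul (K := 𝕜), supportProjection]
  rw [hsub, ← Matrix.nonneg_iff_posSemidef]
  refine cfc_nonneg fun x hx => ?_
  rcases (spectrum_nonneg_of_nonneg hX.nonneg hx).eq_or_lt with rfl | hx0
  · simp
  · rw [mul_inv_cancel₀ hx0.ne', mul_one, sub_nonneg]
    exact hmin x ⟨hx, hx0⟩

end PosSemidef

section HilbertSchmidt

variable {𝕜 ι κ : Type*}

/-- A matrix as a vector of the Euclidean space of its entries, so that the Euclidean norm is the
Hilbert–Schmidt norm. -/
def hsVec (X : Matrix ι κ 𝕜) : EuclideanSpace 𝕜 (ι × κ) :=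
  WithLp.toLp 2 fun p => X p.1 p.2

theorem hsVec_injective : Function.Injective (hsVec : Matrix ι κ 𝕜 → _) := fun _ _ h =>
  Matrix.ext fun i j => congrFun (congrArg WithLp.ofLp h) (i, j)

variable [RCLike 𝕜]

theorem hsVec_smul (c : 𝕜) (X : Matrix ι κ 𝕜) : hsVec (c • X) = c • hsVec X := rfl

theorem hsVec_sum {α : Type*} (s : Finset α) (X : α → Matrix ι κ 𝕜) :
    hsVec (∑ i ∈ s, X i) = ∑ i ∈ s, hsVec (X i) := by
  ext p
  simp only [hsVec, Matrix.sum_apply, WithLp.ofLp_sum, Finset.sum_apply]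

variable [Fintype ι] [Fintype κ]

theorem inner_hsVec (X Y : Matrix ι κ 𝕜) :
    inner 𝕜 (hsVec X) (hsVec Y) = (Y * X.conjTranspose).trace := by
  simp only [PiLp.inner_apply, hsVec, Matrix.trace, Matrix.mul_apply, Matrix.diag,
    Matrix.conjTranspose_apply, Fintype.sum_prod_type, RCLike.inner_apply, RCLike.star_def]

variable {E F : Type*} [NormedAddCommGroup E] [InnerProductSpace 𝕜 E] [NormedAddCommGroup F]
  [InnerProductSpace 𝕜 F]

theorem norm_sum_smul_le {g : ι → E} {d : ι → F} (hg : Orthonormal 𝕜 g) (hd : Orthonormal 𝕜 d)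
    {σ : ι → ℝ} {s : ℝ} (hσ : ∀ i, |σ i| ≤ s) (x : E) :
    ‖∑ i, ((σ i : 𝕜) * inner 𝕜 (g i) x) • d i‖ ^ 2 ≤ s ^ 2 * ‖x‖ ^ 2 := by
  calc ‖∑ i, ((σ i : 𝕜) * inner 𝕜 (g i) x) • d i‖ ^ 2
      = ∑ i, ‖(σ i : 𝕜) * inner 𝕜 (g i) x‖ ^ 2 := by
        rw [← inner_self_eq_norm_sq (𝕜 := 𝕜), hd.inner_sum, map_sum]
        simp only [RCLike.conj_mul, ← RCLike.ofReal_pow, RCLike.ofReal_re]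
    _ ≤ ∑ i, s ^ 2 * ‖inner 𝕜 (g i) x‖ ^ 2 := by
        gcongr with i
        rw [norm_mul, mul_pow, RCLike.norm_ofReal]
        gcongr
        exact hσ i
    _ ≤ s ^ 2 * ‖x‖ ^ 2 := by
        rw [← Finset.mul_sum]
        gcongr
        exact hg.sum_inner_products_le x

/-- The operator on the left has norm at most `s`, so this is the equality case of the
Cauchy–Schwarz inequality. -/
theorem sum_smul_eq_smul_of_le_re_inner {g : ι → E} {d : ι → F} (hg : Orthonormal 𝕜 g)
    (hd : Orthonormal 𝕜 d) {σ : ι → ℝ} {s : ℝ} (hs : 0 ≤ s) (hσ : ∀ i, |σ i| ≤ s) {x : E} {y : F}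
    (hyx : ‖y‖ ≤ ‖x‖)
    (h : s * ‖x‖ ^ 2 ≤ RCLike.re (inner 𝕜 (∑ i, ((σ i : 𝕜) * inner 𝕜 (g i) x) • d i) y)) :
    ∑ i, ((σ i : 𝕜) * inner 𝕜 (g i) x) • d i = (s : 𝕜) • y := by
  have hle := norm_sum_smul_le hg hd hσ x
  set w := ∑ i, ((σ i : 𝕜) * inner 𝕜 (g i) x) • d i
  have hsub : ‖w - (s : 𝕜) • y‖ ^ 2 ≤ 0 :=
    calc ‖w - (s : 𝕜) • y‖ ^ 2 = ‖w‖ ^ 2 - 2 * (s * RCLike.re (inner 𝕜 w y)) + s ^ 2 * ‖y‖ ^ 2 := by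
          rw [norm_sub_sq (𝕜 := 𝕜), inner_smul_right, RCLike.re_ofReal_mul, norm_smul, mul_pow,
            RCLike.norm_ofReal, sq_abs]
      _ ≤ s ^ 2 * ‖x‖ ^ 2 - 2 * (s * (s * ‖x‖ ^ 2)) + s ^ 2 * ‖x‖ ^ 2 := by gcongr
      _ = 0 := by ring
  rwa [sq_nonpos_iff, norm_eq_zero, sub_eq_zero] at hsub

end HilbertSchmidt

section PartialTrace

variable {R ι κ : Type*} [CommRing R] [Fintype ι]

/-- The partial trace over the first factor, the linear map with `C ⊗ D ↦ (tr C) D`. -/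
def partialTrace : Matrix (ι × κ) (ι × κ) R →ₗ[R] Matrix κ κ R where
  toFun M := Matrix.of fun j j' => ∑ i, M (i, j) (i, j')
  map_add' _ _ := Matrix.ext fun _ _ => Finset.sum_add_distrib
  map_smul' _ _ := Matrix.ext fun _ _ => (Finset.mul_sum ..).symm

theorem partialTrace_apply (M : Matrix (ι × κ) (ι × κ) R) (j j' : κ) :
    partialTrace M j j' = ∑ i, M (i, j) (i, j') := rfl

theorem partialTrace_kronecker (C : Matrix ι ι R) (D : Matrix κ κ R) :
    partialTrace (C ⊗ₖ D) = C.trace • D := by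
  ext j j'
  simp only [partialTrace_apply, Matrix.kroneckerMap_apply, ← Finset.sum_mul,
    Matrix.smul_apply, smul_eq_mul, Matrix.trace, Matrix.diag]

variable [Fintype κ]

theorem trace_partialTrace (M : Matrix (ι × κ) (ι × κ) R) : (partialTrace M).trace = M.trace := by
  simp only [partialTrace_apply, Matrix.trace, Matrix.diag, Fintype.sum_prod_type]
  exact Finset.sum_comm

theorem partialTrace_mul_one_kronecker [DecidableEq ι] (M : Matrix (ι × κ) (ι × κ) R)
    (Z : Matrix κ κ R) : partialTrace (M * (1 ⊗ₖ Z)) = partialTrace M * Z := by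
  ext j j'
  calc partialTrace (M * (1 ⊗ₖ Z)) j j'
      = ∑ i, ∑ l, M (i, j) (i, l) * Z l j' := by
        simp only [partialTrace_apply, Matrix.mul_apply, Matrix.kroneckerMap_apply,
          Fintype.sum_prod_type_right,
          Matrix.one_apply, ite_mul, one_mul, zero_mul, mul_ite, mul_zero, Finset.sum_ite_eq',
          Finset.mem_univ, if_true]
    _ = (partialTrace M * Z) j j' := by
        simp only [Matrix.mul_apply, partialTrace_apply, Finset.sum_mul]
        exact Finset.sum_comm

variable [DecidableEq κ]

/-- The contraction of `A` against `X` in the first factor, that is the matrix `Y` with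
`tr (A (X ⊗ Z)) = tr (Y Z)` for all `Z`. -/
def contract (A : Matrix (ι × κ) (ι × κ) R) (X : Matrix ι ι R) : Matrix κ κ R :=
  partialTrace (A * (X ⊗ₖ 1))

theorem contract_add (A : Matrix (ι × κ) (ι × κ) R) (X X' : Matrix ι ι R) :
    contract A (X + X') = contract A X + contract A X' := by
  rw [contract, Matrix.add_kronecker, Matrix.mul_add, map_add, contract, contract]

theorem contract_smul (A : Matrix (ι × κ) (ι × κ) R) (c : R) (X : Matrix ι ι R) :
    contract A (c • X) = c • contract A X := by
  rw [contract, Matrix.smul_kronecker, Matrix.mul_smul, map_smul, contract]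

theorem contract_sum_smul_kronecker {α : Type*} [Fintype α] (c : α → R) (C : α → Matrix ι ι R)
    (D : α → Matrix κ κ R) (X : Matrix ι ι R) :
    contract (∑ i, c i • (C i ⊗ₖ D i)) X = ∑ i, (c i * (C i * X).trace) • D i := by
  simp only [contract, Finset.sum_mul, map_sum, Matrix.smul_mul, map_smul,
    ← Matrix.mul_kronecker_mul, partialTrace_kronecker, Matrix.mul_one, smul_smul]

theorem contract_eq_zero {A : Matrix (ι × κ) (ι × κ) R} {V X : Matrix ι ι R}
    (hA : A * (V ⊗ₖ 1) = 0) (hX : V * X = X) : contract A X = 0 := by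
  rw [contract, ← hX, ← Matrix.mul_one (1 : Matrix κ κ R), Matrix.mul_kronecker_mul,
    ← Matrix.mul_assoc, hA, Matrix.zero_mul, map_zero]

theorem trace_mul_kronecker (A : Matrix (ι × κ) (ι × κ) R) (X : Matrix ι ι R) (Z : Matrix κ κ R) :
    (A * (X ⊗ₖ Z)).trace = (contract A X * Z).trace := by
  classical
  rw [contract, ← partialTrace_mul_one_kronecker, trace_partialTrace, Matrix.mul_assoc,
    ← Matrix.mul_kronecker_mul, Matrix.mul_one, Matrix.one_mul]

variable [DecidableEq ι]

theorem contract_mul_one_kronecker (A : Matrix (ι × κ) (ι × κ) R) (X : Matrix ι ι R)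
    (Z : Matrix κ κ R) : contract (A * (1 ⊗ₖ Z)) X = contract A X * Z := by
  rw [contract, contract, ← partialTrace_mul_one_kronecker, Matrix.mul_assoc, Matrix.mul_assoc,
    ← Matrix.mul_kronecker_mul, ← Matrix.mul_kronecker_mul, Matrix.one_mul, Matrix.mul_one,
    Matrix.one_mul, Matrix.mul_one]

end PartialTrace

section SchmidtPair

variable {R ι κ : Type*}

/-- The matrix obtained by exchanging the two tensor factors, `C ⊗ D ↦ D ⊗ C`. -/
def swapFactors (A : Matrix (ι × κ) (ι × κ) R) : Matrix (κ × ι) (κ × ι) R :=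
  A.submatrix Prod.swap Prod.swap

theorem swapFactors_kronecker [CommRing R] (C : Matrix ι ι R) (D : Matrix κ κ R) :
    swapFactors (C ⊗ₖ D) = D ⊗ₖ C :=
  Matrix.ext fun _ _ => mul_comm _ _

variable [Fintype ι] [Fintype κ] [CommRing R]

theorem swapFactors_mul_kronecker (A : Matrix (ι × κ) (ι × κ) R) (C : Matrix ι ι R)
    (D : Matrix κ κ R) : swapFactors (A * (C ⊗ₖ D)) = swapFactors A * (D ⊗ₖ C) := by
  rw [← swapFactors_kronecker]
  exact Matrix.submatrix_mul _ _ _ _ _ Prod.swap_bijective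

theorem swapFactors_mul_kronecker_eq_zero_iff {A : Matrix (ι × κ) (ι × κ) R} {C : Matrix ι ι R}
    {D : Matrix κ κ R} : swapFactors A * (D ⊗ₖ C) = 0 ↔ A * (C ⊗ₖ D) = 0 := by
  rw [← swapFactors_mul_kronecker]
  exact ⟨fun h => congrArg swapFactors h, fun h => congrArg swapFactors h⟩

theorem trace_swapFactors_mul_kronecker (A : Matrix (ι × κ) (ι × κ) R) (C : Matrix ι ι R)
    (D : Matrix κ κ R) : (swapFactors A * (D ⊗ₖ C)).trace = (A * (C ⊗ₖ D)).trace := by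
  rw [← swapFactors_mul_kronecker]
  exact (Equiv.prodComm κ ι).sum_comp fun p => (A * (C ⊗ₖ D)) p p

variable [DecidableEq ι] [DecidableEq κ]

/-- `X` and `Y` are singular vectors, for the singular value `s`, of the linear map
`contract A` between the two matrix algebras. -/
structure IsSchmidtPair (A : Matrix (ι × κ) (ι × κ) R) (s : R) (X : Matrix ι ι R)
    (Y : Matrix κ κ R) : Prop where
  contract_left : contract A X = s • Y
  contract_right : contract (swapFactors A) Y = s • X

namespace IsSchmidtPair

variable {A : Matrix (ι × κ) (ι × κ) R} {s : R} {X X' : Matrix ι ι R} {Y Y' : Matrix κ κ R}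

theorem swap (h : IsSchmidtPair A s X Y) : IsSchmidtPair (swapFactors A) s Y X :=
  ⟨h.contract_right, h.contract_left⟩

theorem add (h : IsSchmidtPair A s X Y) (h' : IsSchmidtPair A s X' Y') :
    IsSchmidtPair A s (X + X') (Y + Y') :=
  ⟨by rw [contract_add, h.1, h'.1, smul_add], by rw [contract_add, h.2, h'.2, smul_add]⟩

theorem smul (h : IsSchmidtPair A s X Y) (c : R) : IsSchmidtPair A s (c • X) (c • Y) :=
  ⟨by rw [contract_smul, h.1, smul_comm], by rw [contract_smul, h.2, smul_comm]⟩

theorem sub (h : IsSchmidtPair A s X Y) (h' : IsSchmidtPair A s X' Y') :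
    IsSchmidtPair A s (X - X') (Y - Y') := by
  simpa only [sub_eq_add_neg, neg_one_smul] using h.add (h'.smul (-1))

variable [IsDomain R]

theorem right_eq_zero {V : Matrix ι ι R} (h : IsSchmidtPair A s X Y) (hs : s ≠ 0)
    (hA : A * (V ⊗ₖ 1) = 0) (hX : V * X = X) : Y = 0 :=
  (smul_eq_zero.mp (h.contract_left.symm.trans (contract_eq_zero hA hX))).resolve_left hs

theorem left_eq_zero {W : Matrix κ κ R} (h : IsSchmidtPair A s X Y) (hs : s ≠ 0)
    (hA : A * (1 ⊗ₖ W) = 0) (hY : W * Y = Y) : X = 0 :=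
  h.swap.right_eq_zero hs (swapFactors_mul_kronecker_eq_zero_iff.mpr hA) hY

theorem right_mul_eq {W : Matrix κ κ R} (h : IsSchmidtPair A s X Y) (hs : s ≠ 0)
    (hA : A * (1 ⊗ₖ W) = A) : Y * W = Y := by
  refine smul_right_injective _ hs ?_
  simp only [← Matrix.smul_mul, ← h.contract_left, ← contract_mul_one_kronecker, hA]

theorem left_mul_eq {V : Matrix ι ι R} (h : IsSchmidtPair A s X Y) (hs : s ≠ 0)
    (hA : A * (V ⊗ₖ 1) = A) : X * V = X :=
  h.swap.right_mul_eq hs ((swapFactors_mul_kronecker ..).symm.trans (congrArg swapFactors hA))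

end IsSchmidtPair

end SchmidtPair

section SupportProjection

variable {𝕜 ι κ : Type*} [RCLike 𝕜] [Fintype ι] [Fintype κ] {A : Matrix (ι × κ) (ι × κ) 𝕜}

theorem norm_hsVec_add_eq_norm_hsVec_sub {P N : Matrix ι ι 𝕜} (hN : N.IsHermitian)
    (h : P * N = 0) : ‖hsVec (P + N)‖ = ‖hsVec (P - N)‖ := by
  have h0 : inner 𝕜 (hsVec N) (hsVec P) = 0 := by rw [inner_hsVec, hN.eq, h, Matrix.trace_zero]
  have hadd : hsVec (P + N) = hsVec P + hsVec N := rfl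
  have hsub : hsVec (P - N) = hsVec P - hsVec N := rfl
  rw [← sq_eq_sq₀ (norm_nonneg _) (norm_nonneg _), hadd, hsub, norm_add_sq (𝕜 := 𝕜),
    norm_sub_sq (𝕜 := 𝕜), inner_eq_zero_symm.mp h0, map_zero, mul_zero, add_zero, sub_zero]

theorem trace_mul_sub_kronecker_sub_le {P N : Matrix ι ι 𝕜} {Q R : Matrix κ κ 𝕜}
    (hA : A.PosSemidef) (hP : P.PosSemidef) (hN : N.PosSemidef) (hQ : Q.PosSemidef)
    (hR : R.PosSemidef) :
    (A * ((P - N) ⊗ₖ (Q - R))).trace ≤ (A * ((P + N) ⊗ₖ (Q + R))).trace := by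
  have hdiff : (P + N) ⊗ₖ (Q + R) = (P - N) ⊗ₖ (Q - R) + (2 : ℝ) • (P ⊗ₖ R + N ⊗ₖ Q) := by
    simp only [Matrix.add_kronecker, Matrix.kronecker_add, sub_kronecker, kronecker_sub]
    module
  rw [hdiff, Matrix.mul_add, Matrix.trace_add, le_add_iff_nonneg_right]
  exact trace_mul_nonneg hA (((hP.kronecker hR).add (hN.kronecker hQ)).smul zero_le_two)

variable [DecidableEq ι] [DecidableEq κ] {s : 𝕜} {X : Matrix ι ι 𝕜} {Y : Matrix κ κ 𝕜}

namespace IsSchmidtPair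

theorem mul_supportProjection_kronecker_one_sub (h : IsSchmidtPair A s X Y) (hA : A.PosSemidef)
    (hX : X.PosSemidef) (hY : Y.IsHermitian) :
    A * (supportProjection X ⊗ₖ (1 - supportProjection Y)) = 0 := by
  have hAX : A * (X ⊗ₖ (1 - supportProjection Y)) = 0 := by
    refine mul_eq_zero_of_trace_mul_eq_zero hA (hX.kronecker (posSemidef_of_isStarProjection
      (isStarProjection_supportProjection Y).one_sub)) ?_
    rw [trace_mul_kronecker, h.contract_left, Matrix.smul_mul, Matrix.mul_sub, Matrix.mul_one,
      mul_supportProjection hY, sub_self, smul_zero, Matrix.trace_zero]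
  rw [supportProjection_eq_mul_cfc_inv hX.isHermitian,
    ← Matrix.mul_one (1 - supportProjection Y), Matrix.mul_kronecker_mul, ← Matrix.mul_assoc, hAX,
    Matrix.zero_mul]

theorem mul_one_sub_kronecker_supportProjection (h : IsSchmidtPair A s X Y) (hA : A.PosSemidef)
    (hX : X.IsHermitian) (hY : Y.PosSemidef) :
    A * ((1 - supportProjection X) ⊗ₖ supportProjection Y) = 0 :=
  swapFactors_mul_kronecker_eq_zero_iff.mp
    (h.swap.mul_supportProjection_kronecker_one_sub (hA.submatrix _) hY hX)

end IsSchmidtPair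

end SupportProjection

section PartialTranspose

variable {k m : ℕ} {A : BipartiteMatrix k m}

theorem sum_sum_exchange_fst {ι κ M : Type*} [Fintype ι] [Fintype κ] [AddCommMonoid M]
    (f : ι × κ → ι × κ → M) :
    ∑ p, ∑ q, f p q = ∑ p : ι × κ, ∑ q : ι × κ, f (q.1, p.2) (p.1, q.2) := by
  simp only [Fintype.sum_prod_type]
  calc ∑ a, ∑ b, ∑ c, ∑ d, f (a, b) (c, d) = ∑ a, ∑ c, ∑ b, ∑ d, f (a, b) (c, d) :=
        Finset.sum_congr rfl fun _ _ => Finset.sum_comm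
    _ = ∑ c, ∑ a, ∑ b, ∑ d, f (a, b) (c, d) := Finset.sum_comm
    _ = ∑ c, ∑ b, ∑ a, ∑ d, f (a, b) (c, d) := Finset.sum_congr rfl fun _ _ => Finset.sum_comm

theorem partialTranspose_kronecker_mul_kronecker (A : BipartiteMatrix k m)
    (V V' : Matrix (Fin k) (Fin k) ℂ) (W W' : Matrix (Fin m) (Fin m) ℂ) :
    partialTranspose ((V ⊗ₖ W) * A * (V' ⊗ₖ W')) =
      (V'.transpose ⊗ₖ W) * partialTranspose A * (V.transpose ⊗ₖ W') := by
  ext p q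
  simp only [partialTranspose, Matrix.of_apply, Matrix.mul_apply, Matrix.kroneckerMap_apply,
    Matrix.transpose_apply, Finset.sum_mul]
  rw [sum_sum_exchange_fst]
  refine Finset.sum_congr rfl fun _ _ => Finset.sum_congr rfl fun _ _ => ?_
  ring

theorem trace_partialTranspose_mul_kronecker (A : BipartiteMatrix k m)
    (V : Matrix (Fin k) (Fin k) ℂ) (W : Matrix (Fin m) (Fin m) ℂ) :
    (partialTranspose A * (V.transpose ⊗ₖ W)).trace = (A * (V ⊗ₖ W)).trace :=
  calc (partialTranspose A * (V.transpose ⊗ₖ W)).trace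
      = (partialTranspose ((V ⊗ₖ 1) * A * (1 ⊗ₖ W))).trace := by
        rw [partialTranspose_kronecker_mul_kronecker, Matrix.transpose_one,
          Matrix.one_kronecker_one, Matrix.one_mul]
    _ = ((V ⊗ₖ 1) * A * (1 ⊗ₖ W)).trace := rfl
    _ = (A * (V ⊗ₖ W)).trace := by
        rw [Matrix.mul_assoc, Matrix.trace_mul_comm, Matrix.mul_assoc, ← Matrix.mul_kronecker_mul,
          Matrix.one_mul, Matrix.mul_one]

variable {V : Matrix (Fin k) (Fin k) ℂ} {W : Matrix (Fin m) (Fin m) ℂ}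

theorem IsPPT.kronecker_mul_mul_kronecker_eq_zero (hA : IsPPT A) (hV : IsStarProjection V)
    (hW : IsStarProjection W) (h : A * (V ⊗ₖ (1 - W)) = 0) :
    (V ⊗ₖ W) * A * ((1 - V) ⊗ₖ (1 - W)) = 0 := by
  have hT : partialTranspose A * (V.transpose ⊗ₖ (1 - W)) = 0 := by
    refine mul_eq_zero_of_trace_mul_eq_zero hA.2
      ((posSemidef_of_isStarProjection hV).transpose.kronecker
        (posSemidef_of_isStarProjection hW.one_sub)) ?_
    rw [trace_partialTranspose_mul_kronecker, h, Matrix.trace_zero]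
  have h0 : partialTranspose ((V ⊗ₖ W) * A * ((1 - V) ⊗ₖ (1 - W))) = 0 := by
    rw [partialTranspose_kronecker_mul_kronecker, Matrix.mul_assoc, hT, Matrix.mul_zero]
  exact Matrix.ext fun p q => congrFun (congrFun h0 (q.1, p.2)) (p.1, q.2)

theorem IsPPT.eq_add_of_mul_kronecker_eq_zero (hA : IsPPT A) (hV : IsStarProjection V)
    (hW : IsStarProjection W) (h₁ : A * (V ⊗ₖ (1 - W)) = 0) (h₂ : A * ((1 - V) ⊗ₖ W) = 0) :
    A = (V ⊗ₖ W) * A * (V ⊗ₖ W) + ((1 - V) ⊗ₖ (1 - W)) * A * ((1 - V) ⊗ₖ (1 - W)) := by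
  set S := V ⊗ₖ W with hS
  set S' := (1 - V) ⊗ₖ (1 - W) with hS'
  have hsum : S + S' + V ⊗ₖ (1 - W) + (1 - V) ⊗ₖ W = 1 := by
    simp only [hS, hS', sub_kronecker, kronecker_sub, Matrix.one_kronecker_one]
    abel
  have hright : A * (S + S') = A := by
    have h := congrArg (A * ·) hsum
    simpa only [Matrix.mul_add, h₁, h₂, add_zero, Matrix.mul_one] using h
  have hSA : star S = S := (isStarProjection_kronecker hV hW).isSelfAdjoint
  have hSA' : star S' = S' := (isStarProjection_kronecker hV.one_sub hW.one_sub).isSelfAdjoint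
  have hAA : star A = A := hA.1.isHermitian
  have hleft : (S + S') * A = A := by
    simpa only [star_mul, star_add, hSA, hSA', hAA] using congrArg star hright
  have h0 : S * A * S' = 0 := hA.kronecker_mul_mul_kronecker_eq_zero hV hW h₁
  have h0' : S' * A * S = 0 := by
    simpa only [star_mul, hSA, hSA', hAA, star_zero, Matrix.mul_assoc] using congrArg star h0
  calc A = (S + S') * A * (S + S') := by rw [hleft, hright]
    _ = S * A * S + S' * A * S' + S * A * S' + S' * A * S := by noncomm_ring
    _ = S * A * S + S' * A * S' := by rw [h0, h0', add_zero, add_zero]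

theorem IsWeakIrreducible.mul_kronecker_one_eq_zero_or (hw : IsWeakIrreducible A) (hA : IsPPT A)
    (hV : IsStarProjection V) (hW : IsStarProjection W) (h₁ : A * (V ⊗ₖ (1 - W)) = 0)
    (h₂ : A * ((1 - V) ⊗ₖ W) = 0) :
    (A * (V ⊗ₖ 1) = 0 ∧ A * (1 ⊗ₖ W) = 0) ∨
      (A * ((1 - V) ⊗ₖ 1) = 0 ∧ A * (1 ⊗ₖ (1 - W)) = 0) := by
  have hproj {n : ℕ} {Z : Matrix (Fin n) (Fin n) ℂ} (hZ : IsStarProjection Z) :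
      Z.IsHermitian ∧ Z * Z = Z := ⟨hZ.isSelfAdjoint, hZ.isIdempotentElem⟩
  have hleft (V : Matrix (Fin k) (Fin k) ℂ) (h : A * (V ⊗ₖ W) = 0)
      (h' : A * (V ⊗ₖ (1 - W)) = 0) : A * (V ⊗ₖ 1) = 0 := by
    rw [← add_sub_cancel W 1, Matrix.kronecker_add, Matrix.mul_add, h, h', add_zero]
  have hright (W : Matrix (Fin m) (Fin m) ℂ) (h : A * (V ⊗ₖ W) = 0)
      (h' : A * ((1 - V) ⊗ₖ W) = 0) : A * (1 ⊗ₖ W) = 0 := by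
    rw [← add_sub_cancel V 1, Matrix.add_kronecker, Matrix.mul_add, h, h', add_zero]
  refine (hw.2 V (1 - V) W (1 - W) (hproj hV) (hproj hV.one_sub) (hproj hW) (hproj hW.one_sub)
    hV.isIdempotentElem.mul_one_sub_self hW.isIdempotentElem.mul_one_sub_self
    (add_sub_cancel _ _) (add_sub_cancel _ _)
    (hA.eq_add_of_mul_kronecker_eq_zero hV hW h₁ h₂)).imp (fun h => ?_) fun h => ?_
  · have h₃ := mul_eq_zero_of_mul_mul_eq_zero hA.1 (isStarProjection_kronecker hV hW) h
    exact ⟨hleft V h₃ h₁, hright W h₃ h₂⟩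
  · have h₃ := mul_eq_zero_of_mul_mul_eq_zero hA.1
      (isStarProjection_kronecker hV.one_sub hW.one_sub) h
    exact ⟨hleft (1 - V) h₂ h₃, hright (1 - W) h₁ h₃⟩

end PartialTranspose

section SchmidtDecomposition

variable {k m n : ℕ} {A : BipartiteMatrix k m} {lam : Fin n → ℝ}
  {γ : Fin n → Matrix (Fin k) (Fin k) ℂ} {δ : Fin n → Matrix (Fin m) (Fin m) ℂ}

theorem IsOrthonormalFamily.orthonormal_hsVec (h : IsOrthonormalFamily γ) :
    Orthonormal ℂ fun i => hsVec (γ i) := by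
  rw [orthonormal_iff_ite]
  intro i j
  rw [inner_hsVec, h j i]
  exact if_congr eq_comm rfl rfl

namespace IsHermitianSchmidtDecomposition

theorem neg (h : IsHermitianSchmidtDecomposition A lam γ δ) :
    IsHermitianSchmidtDecomposition A lam (fun i => -γ i) fun i => -δ i where
  lam_pos := h.lam_pos
  hermitian_left i := (h.hermitian_left i).neg
  hermitian_right i := (h.hermitian_right i).neg
  orthonormal_left i j := by
    rw [Matrix.conjTranspose_neg, neg_mul_neg, h.orthonormal_left i j]
  orthonormal_right i j := by
    rw [Matrix.conjTranspose_neg, neg_mul_neg, h.orthonormal_right i j]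
  eq_sum := by simp only [neg_kronecker_neg, h.eq_sum]

theorem swap (h : IsHermitianSchmidtDecomposition A lam γ δ) :
    IsHermitianSchmidtDecomposition (swapFactors A) lam δ γ where
  lam_pos := h.lam_pos
  hermitian_left := h.hermitian_right
  hermitian_right := h.hermitian_left
  orthonormal_left := h.orthonormal_right
  orthonormal_right := h.orthonormal_left
  eq_sum := by
    rw [h.eq_sum]
    ext p q
    simp only [swapFactors, Matrix.submatrix_apply, Matrix.sum_apply, Matrix.smul_apply,
      Matrix.kroneckerMap_apply, Prod.fst_swap, Prod.snd_swap, mul_comm (δ _ _ _)]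

theorem contract_eq_sum (h : IsHermitianSchmidtDecomposition A lam γ δ)
    (X : Matrix (Fin k) (Fin k) ℂ) :
    contract A X = ∑ i, ((lam i : ℂ) * inner ℂ (hsVec (γ i)) (hsVec X)) • δ i := by
  simp only [h.eq_sum, contract_sum_smul_kronecker, inner_hsVec, (h.hermitian_left _).eq,
    Matrix.trace_mul_comm X]

theorem contract_left_eq_smul (h : IsHermitianSchmidtDecomposition A lam γ δ) (i : Fin n) :
    contract A (γ i) = (lam i : ℂ) • δ i := by
  simp only [h.contract_eq_sum, orthonormal_iff_ite.mp h.orthonormal_left.orthonormal_hsVec,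
    mul_ite, mul_one, mul_zero, ite_smul, zero_smul, Finset.sum_ite_eq', Finset.mem_univ, if_true]

theorem isSchmidtPair (h : IsHermitianSchmidtDecomposition A lam γ δ) (i : Fin n) :
    IsSchmidtPair A (lam i : ℂ) (γ i) (δ i) :=
  ⟨h.contract_left_eq_smul i, h.swap.contract_left_eq_smul i⟩

variable {i₀ : Fin n} {X : Matrix (Fin k) (Fin k) ℂ} {Y : Matrix (Fin m) (Fin m) ℂ}

theorem contract_eq_smul (h : IsHermitianSchmidtDecomposition A lam γ δ)
    (hmax : ∀ i, lam i ≤ lam i₀) (hY : Y.IsHermitian) (hYX : ‖hsVec Y‖ ≤ ‖hsVec X‖)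
    (hle : lam i₀ * ‖hsVec X‖ ^ 2 ≤ (A * (X ⊗ₖ Y)).trace.re) :
    contract A X = (lam i₀ : ℂ) • Y := by
  have hsum : hsVec (contract A X) =
      ∑ i, ((lam i : ℂ) * inner ℂ (hsVec (γ i)) (hsVec X)) • hsVec (δ i) := by
    simp only [h.contract_eq_sum, hsVec_sum, hsVec_smul]
  have hre : lam i₀ * ‖hsVec X‖ ^ 2 ≤ (inner ℂ (hsVec (contract A X)) (hsVec Y)).re := by
    rwa [← RCLike.re_eq_complex_re, inner_re_symm, inner_hsVec, hY.eq, ← trace_mul_kronecker]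
  refine hsVec_injective ?_
  rw [hsVec_smul, hsum]
  rw [hsum] at hre
  exact sum_smul_eq_smul_of_le_re_inner (𝕜 := ℂ) h.orthonormal_left.orthonormal_hsVec
    h.orthonormal_right.orthonormal_hsVec (h.lam_pos i₀).le
    (fun i => (abs_of_pos (h.lam_pos i)).trans_le (hmax i)) hYX hre

theorem isSchmidtPair_of_le (h : IsHermitianSchmidtDecomposition A lam γ δ)
    (hmax : ∀ i, lam i ≤ lam i₀) (hX : X.IsHermitian) (hY : Y.IsHermitian)
    (hYX : ‖hsVec Y‖ = ‖hsVec X‖) (hle : lam i₀ * ‖hsVec X‖ ^ 2 ≤ (A * (X ⊗ₖ Y)).trace.re) :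
    IsSchmidtPair A (lam i₀ : ℂ) X Y where
  contract_left := h.contract_eq_smul hmax hY hYX.le hle
  contract_right := h.swap.contract_eq_smul hmax hX hYX.ge (by
    rwa [trace_swapFactors_mul_kronecker, hYX])

variable {P N : Matrix (Fin k) (Fin k) ℂ} {Q R : Matrix (Fin m) (Fin m) ℂ}

theorem isSchmidtPair_add_add (h : IsHermitianSchmidtDecomposition A lam γ δ)
    (hmax : ∀ i, lam i ≤ lam i₀) (hA : A.PosSemidef) (hP : P.PosSemidef) (hN : N.PosSemidef)
    (hPN : P * N = 0) (hγ : γ i₀ = P - N) (hQ : Q.PosSemidef) (hR : R.PosSemidef)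
    (hQR : Q * R = 0) (hδ : δ i₀ = Q - R) :
    IsSchmidtPair A (lam i₀ : ℂ) (P + N) (Q + R) := by
  have hX : ‖hsVec (P + N)‖ = 1 := by
    rw [norm_hsVec_add_eq_norm_hsVec_sub hN.isHermitian hPN, ← hγ]
    exact h.orthonormal_left.orthonormal_hsVec.1 i₀
  have hY : ‖hsVec (Q + R)‖ = 1 := by
    rw [norm_hsVec_add_eq_norm_hsVec_sub hR.isHermitian hQR, ← hδ]
    exact h.orthonormal_right.orthonormal_hsVec.1 i₀
  have htrace : (A * (γ i₀ ⊗ₖ δ i₀)).trace = lam i₀ := by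
    rw [trace_mul_kronecker, h.contract_left_eq_smul, Matrix.smul_mul, Matrix.trace_smul]
    nth_rw 2 [← (h.hermitian_right i₀).eq]
    rw [h.orthonormal_right, if_pos rfl, smul_eq_mul, mul_one]
  refine h.isSchmidtPair_of_le hmax (hP.add hN).isHermitian (hQ.add hR).isHermitian
    (hY.trans hX.symm) ?_
  calc lam i₀ * ‖hsVec (P + N)‖ ^ 2 = (A * ((P - N) ⊗ₖ (Q - R))).trace.re := by
        rw [hX, one_pow, mul_one, ← hγ, ← hδ, htrace, Complex.ofReal_re]
    _ ≤ (A * ((P + N) ⊗ₖ (Q + R))).trace.re :=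
        (Complex.le_def.mp (trace_mul_sub_kronecker_sub_le hA hP hN hQ hR)).1

theorem isSchmidtPair_posPart_and_negPart (h : IsHermitianSchmidtDecomposition A lam γ δ)
    (hmax : ∀ i, lam i ≤ lam i₀) (hA : A.PosSemidef) (hP : P.PosSemidef) (hN : N.PosSemidef)
    (hPN : P * N = 0) (hγ : γ i₀ = P - N) (hQ : Q.PosSemidef) (hR : R.PosSemidef)
    (hQR : Q * R = 0) (hδ : δ i₀ = Q - R) :
    IsSchmidtPair A (lam i₀ : ℂ) P Q ∧ IsSchmidtPair A (lam i₀ : ℂ) N R := by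
  have hadd := h.isSchmidtPair_add_add hmax hA hP hN hPN hγ hQ hR hQR hδ
  have hsub : IsSchmidtPair A (lam i₀ : ℂ) (P - N) (Q - R) := hγ ▸ hδ ▸ h.isSchmidtPair i₀
  constructor
  · convert (hadd.add hsub).smul (1 / 2) using 1 <;> module
  · convert (hadd.sub hsub).smul (1 / 2) using 1 <;> module

end IsHermitianSchmidtDecomposition

end SchmidtDecomposition

section WeakIrreducible

variable {k m : ℕ} {A : BipartiteMatrix k m} {s : ℂ} {P N : Matrix (Fin k) (Fin k) ℂ}
  {Q R : Matrix (Fin m) (Fin m) ℂ}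

namespace IsSchmidtPair

theorem mul_kronecker_one_eq_zero_or (h : IsSchmidtPair A s P Q) (hw : IsWeakIrreducible A)
    (hA : IsPPT A) (hP : P.PosSemidef) (hQ : Q.PosSemidef) :
    (A * (supportProjection P ⊗ₖ 1) = 0 ∧ A * (1 ⊗ₖ supportProjection Q) = 0) ∨
      (A * ((1 - supportProjection P) ⊗ₖ 1) = 0 ∧ A * (1 ⊗ₖ (1 - supportProjection Q)) = 0) :=
  hw.mul_kronecker_one_eq_zero_or hA (isStarProjection_supportProjection P)
    (isStarProjection_supportProjection Q)
    (h.mul_supportProjection_kronecker_one_sub hA.1 hP hQ.isHermitian)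
    (h.mul_one_sub_kronecker_supportProjection hA.1 hP.isHermitian hQ)

theorem eq_zero_or_eq_zero_of_mul_eq_zero (h : IsSchmidtPair A s P Q)
    (h' : IsSchmidtPair A s N R) (hs : s ≠ 0) (hw : IsWeakIrreducible A) (hA : IsPPT A)
    (hP : P.PosSemidef) (hQ : Q.PosSemidef) (hPN : P * N = 0) (hQR : Q * R = 0) :
    (P = 0 ∧ Q = 0) ∨ (N = 0 ∧ R = 0) := by
  refine (h.mul_kronecker_one_eq_zero_or hw hA hP hQ).imp (fun ⟨hA₁, hA₂⟩ => ?_)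
    fun ⟨hA₁, hA₂⟩ => ?_
  · exact ⟨h.left_eq_zero hs hA₂ (supportProjection_mul hQ.isHermitian),
      h.right_eq_zero hs hA₁ (supportProjection_mul hP.isHermitian)⟩
  · refine ⟨h'.left_eq_zero hs hA₂ ?_, h'.right_eq_zero hs hA₁ ?_⟩
    · rw [Matrix.sub_mul, Matrix.one_mul, supportProjection_mul_eq_zero hQ.isHermitian hQR,
        sub_zero]
    · rw [Matrix.sub_mul, Matrix.one_mul, supportProjection_mul_eq_zero hP.isHermitian hPN,
        sub_zero]

theorem mul_supportProjection_kronecker_one (h : IsSchmidtPair A s P Q) (hs : s ≠ 0)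
    (hw : IsWeakIrreducible A) (hA : IsPPT A) (hP : P.PosSemidef) (hQ : Q.PosSemidef)
    (hP0 : P ≠ 0) :
    A * (supportProjection P ⊗ₖ 1) = A ∧ A * (1 ⊗ₖ supportProjection Q) = A := by
  rcases h.mul_kronecker_one_eq_zero_or hw hA hP hQ with ⟨-, hA₂⟩ | ⟨hA₁, hA₂⟩
  · exact absurd (h.left_eq_zero hs hA₂ (supportProjection_mul hQ.isHermitian)) hP0
  · rw [sub_kronecker, Matrix.one_kronecker_one, Matrix.mul_sub, Matrix.mul_one, sub_eq_zero] at hA₁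
    rw [kronecker_sub, Matrix.one_kronecker_one, Matrix.mul_sub, Matrix.mul_one, sub_eq_zero] at hA₂
    exact ⟨hA₁.symm, hA₂.symm⟩

end IsSchmidtPair

variable {n : ℕ} {lam : Fin n → ℝ} {γ : Fin n → Matrix (Fin k) (Fin k) ℂ}
  {δ : Fin n → Matrix (Fin m) (Fin m) ℂ} {i₀ : Fin n}

theorem IsHermitianSchmidtDecomposition.posSemidef_or_posSemidef_neg
    (h : IsHermitianSchmidtDecomposition A lam γ δ) (hmax : ∀ i, lam i ≤ lam i₀)
    (hw : IsWeakIrreducible A) (hA : IsPPT A) :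
    ((γ i₀).PosSemidef ∧ (δ i₀).PosSemidef) ∨ ((-γ i₀).PosSemidef ∧ (-δ i₀).PosSemidef) := by
  obtain ⟨P, N, hP, hN, hPN, hγ⟩ := exists_posSemidef_eq_sub (h.hermitian_left i₀)
  obtain ⟨Q, R, hQ, hR, hQR, hδ⟩ := exists_posSemidef_eq_sub (h.hermitian_right i₀)
  obtain ⟨hPQ, hNR⟩ :=
    h.isSchmidtPair_posPart_and_negPart hmax hA.1 hP hN hPN hγ hQ hR hQR hδ
  rcases hPQ.eq_zero_or_eq_zero_of_mul_eq_zero hNR (Complex.ofReal_ne_zero.mpr (h.lam_pos i₀).ne')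
    hw hA hP hQ hPN hQR with ⟨rfl, rfl⟩ | ⟨rfl, rfl⟩
  · exact .inr ⟨by rwa [hγ, zero_sub, neg_neg], by rwa [hδ, zero_sub, neg_neg]⟩
  · exact .inl ⟨by rwa [hγ, sub_zero], by rwa [hδ, sub_zero]⟩

end WeakIrreducible

section Separable

variable {k m : ℕ} {A B : BipartiteMatrix k m} {V X : Matrix (Fin k) (Fin k) ℂ}
  {W Y : Matrix (Fin m) (Fin m) ℂ}

theorem IsSeparableMatrix.of_fintype {ι : Type*} [Fintype ι] {C : ι → Matrix (Fin k) (Fin k) ℂ}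
    {D : ι → Matrix (Fin m) (Fin m) ℂ} (hC : ∀ i, (C i).PosSemidef) (hD : ∀ i, (D i).PosSemidef) :
    IsSeparableMatrix (∑ i, C i ⊗ₖ D i) :=
  let e := (Fintype.equivFin ι).symm
  ⟨Fintype.card ι, C ∘ e, D ∘ e, fun _ => hC _, fun _ => hD _,
    (e.sum_comp fun i => C i ⊗ₖ D i).symm⟩

theorem IsSeparableMatrix.sum {ι : Type*} [Fintype ι] {A : ι → BipartiteMatrix k m}
    (h : ∀ i, IsSeparableMatrix (A i)) : IsSeparableMatrix (∑ i, A i) := by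
  choose n C D hC hD hA using h
  rw [Finset.sum_congr rfl fun i _ => hA i, ← Fintype.sum_sigma' fun i j => C i j ⊗ₖ D i j]
  exact .of_fintype (fun p => hC p.1 p.2) fun p => hD p.1 p.2

theorem IsSeparableMatrix.kronecker (hX : X.PosSemidef) (hY : Y.PosSemidef) :
    IsSeparableMatrix (X ⊗ₖ Y) :=
  ⟨1, fun _ => X, fun _ => Y, fun _ => hX, fun _ => hY, (Fin.sum_univ_one fun _ => X ⊗ₖ Y).symm⟩

theorem IsSeparableMatrix.add (hA : IsSeparableMatrix A) (hB : IsSeparableMatrix B) :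
    IsSeparableMatrix (A + B) := by
  have h := IsSeparableMatrix.sum (A := fun b => bif b then A else B) (Bool.rec hB hA)
  rwa [Fintype.sum_bool] at h

theorem IsSeparableMatrix.smul (hA : IsSeparableMatrix A) {c : ℝ} (hc : 0 ≤ c) :
    IsSeparableMatrix ((c : ℂ) • A) := by
  obtain ⟨n, C, D, hC, hD, rfl⟩ := hA
  refine ⟨n, fun i => (c : ℂ) • C i, D, fun i => (hC i).smul (Complex.zero_le_real.mpr hc), hD, ?_⟩
  simp only [Finset.smul_sum, Matrix.smul_kronecker]

theorem IsSeparableMatrix.posSemidef (hA : IsSeparableMatrix A) : A.PosSemidef := by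
  obtain ⟨n, C, D, hC, hD, rfl⟩ := hA
  exact Matrix.posSemidef_sum _ fun i _ => (hC i).kronecker (hD i)

theorem isSeparableMatrix_kronecker_add_kronecker (hV : (V + X).PosSemidef)
    (hV' : (V - X).PosSemidef) (hW : (W + Y).PosSemidef) (hW' : (W - Y).PosSemidef) :
    IsSeparableMatrix (V ⊗ₖ W + X ⊗ₖ Y) := by
  convert ((IsSeparableMatrix.kronecker hV hW).add (.kronecker hV' hW')).smul
    (inv_nonneg.mpr zero_le_two) using 1
  simp only [Matrix.add_kronecker, Matrix.kronecker_add, sub_kronecker, kronecker_sub,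
    Complex.ofReal_inv, Complex.ofReal_ofNat]
  module

theorem isSeparableMatrix_kronecker_sub_smul_kronecker (hV : V.PosSemidef) (hW : W.PosSemidef)
    (hY : Y.PosSemidef) {a b c : ℝ} (ha : 0 ≤ a) (hXV : (X - (a : ℂ) • V).PosSemidef)
    (hYW : (Y - (b : ℂ) • W).PosSemidef) (hc : c ≤ a * b) :
    IsSeparableMatrix (X ⊗ₖ Y - (c : ℂ) • (V ⊗ₖ W)) := by
  convert ((IsSeparableMatrix.kronecker hXV hY).add ((IsSeparableMatrix.kronecker hV hYW).smul
    ha)).add ((IsSeparableMatrix.kronecker hV hW).smul (sub_nonneg.mpr hc)) using 1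
  simp only [sub_kronecker, kronecker_sub, Matrix.smul_kronecker, Matrix.kronecker_smul,
    Complex.ofReal_sub, Complex.ofReal_mul]
  module

theorem isSeparableMatrix_kronecker_sub_smul_supportProjection (hX : X.PosSemidef)
    (hY : Y.PosSemidef) (hX0 : X ≠ 0) (hY0 : Y ≠ 0) {μ : ℝ}
    (hμ : IsLeastPositiveEigenvalue (X ⊗ₖ Y) μ) :
    IsSeparableMatrix (X ⊗ₖ Y - (μ : ℂ) • (supportProjection X ⊗ₖ supportProjection Y)) := by
  obtain ⟨a, ha, haX, hXV⟩ := exists_hasEigenvalue_posSemidef_sub_smul_supportProjection hX hX0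
  obtain ⟨b, hb, hbY, hYW⟩ := exists_hasEigenvalue_posSemidef_sub_smul_supportProjection hY hY0
  have hab : μ ≤ a * b :=
    hμ.2 ⟨mul_pos ha hb, by simpa using hasEigenvalue_kronecker haX hbY⟩
  exact isSeparableMatrix_kronecker_sub_smul_kronecker
    (posSemidef_of_isStarProjection (isStarProjection_supportProjection X))
    (posSemidef_of_isStarProjection (isStarProjection_supportProjection Y)) hY ha.le hXV hYW hab

theorem posSemidef_sub_of_mul_eq {𝕜 ι : Type*} [RCLike 𝕜] [Fintype ι] {V X : Matrix ι ι 𝕜}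
    (hV : IsStarProjection V) (hX : X.IsHermitian) (htr : (X * X).trace = 1) (hXV : X * V = X) :
    (V - X).PosSemidef := by
  classical
  have hVX : V * X = X := by
    simpa only [star_mul, hV.isSelfAdjoint.star_eq, hX.isSelfAdjoint.star_eq] using
      congrArg star hXV
  have h := (posSemidef_one_sub_of_trace_mul_self hX htr).mul_mul_conjTranspose_same V
  rwa [← Matrix.star_eq_conjTranspose, hV.isSelfAdjoint.star_eq, Matrix.mul_sub, Matrix.mul_one,
    Matrix.sub_mul, hV.isIdempotentElem.eq, hVX, hXV] at h

theorem isSeparableMatrix_isStarProjection_kronecker_add (hV : IsStarProjection V)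
    (hW : IsStarProjection W) (hX : X.IsHermitian) (hY : Y.IsHermitian)
    (hXX : (X * X).trace = 1) (hYY : (Y * Y).trace = 1) (hXV : X * V = X) (hYW : Y * W = Y) :
    IsSeparableMatrix (V ⊗ₖ W + X ⊗ₖ Y) := by
  have hneg {l : ℕ} {U Z : Matrix (Fin l) (Fin l) ℂ} (hU : IsStarProjection U)
      (hZ : Z.IsHermitian) (hZZ : (Z * Z).trace = 1) (hZU : Z * U = Z) : (U + Z).PosSemidef := by
    rw [← sub_neg_eq_add]
    exact posSemidef_sub_of_mul_eq hU hZ.neg (by rwa [neg_mul_neg]) (by rw [neg_mul, hZU])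
  exact isSeparableMatrix_kronecker_add_kronecker (hneg hV hX hXX hXV)
    (posSemidef_sub_of_mul_eq hV hX hXX hXV) (hneg hW hY hYY hYW)
    (posSemidef_sub_of_mul_eq hW hY hYY hYW)

end Separable

section SeparabilityCriterion

variable {k m n : ℕ} {A : BipartiteMatrix k m} {lam : Fin (n + 1) → ℝ}
  {γ : Fin (n + 1) → Matrix (Fin k) (Fin k) ℂ} {δ : Fin (n + 1) → Matrix (Fin m) (Fin m) ℂ}
  {μ : ℝ} {V : Matrix (Fin k) (Fin k) ℂ} {W : Matrix (Fin m) (Fin m) ℂ}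

namespace IsHermitianSchmidtDecomposition

theorem isSeparableMatrix_of_sum_le (h : IsHermitianSchmidtDecomposition A lam γ δ)
    (hV : IsStarProjection V) (hW : IsStarProjection W) (hAV : A * (V ⊗ₖ 1) = A)
    (hAW : A * (1 ⊗ₖ W) = A)
    (h₀ : IsSeparableMatrix (γ 0 ⊗ₖ δ 0 - (μ : ℂ) • (V ⊗ₖ W)))
    (hle : ∑ i : Fin n, lam i.succ ≤ lam 0 * μ) : IsSeparableMatrix A := by
  have hVW (i) : IsSeparableMatrix (V ⊗ₖ W + γ i ⊗ₖ δ i) := by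
    have hi : (lam i : ℂ) ≠ 0 := Complex.ofReal_ne_zero.mpr (h.lam_pos i).ne'
    refine isSeparableMatrix_isStarProjection_kronecker_add hV hW (h.hermitian_left i)
      (h.hermitian_right i) ?_ ?_ ((h.isSchmidtPair i).left_mul_eq hi hAV)
      ((h.isSchmidtPair i).right_mul_eq hi hAW)
    · simpa only [(h.hermitian_left i).eq, if_true] using h.orthonormal_left i i
    · simpa only [(h.hermitian_right i).eq, if_true] using h.orthonormal_right i i
  have hA : A = (lam 0 : ℂ) • (γ 0 ⊗ₖ δ 0 - (μ : ℂ) • (V ⊗ₖ W)) +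
      ((lam 0 * μ - ∑ i : Fin n, lam i.succ : ℝ) : ℂ) • (V ⊗ₖ W) +
      ∑ i : Fin n, (lam i.succ : ℂ) • (V ⊗ₖ W + γ i.succ ⊗ₖ δ i.succ) := by
    simp only [smul_add, Finset.sum_add_distrib, ← Finset.sum_smul, Complex.ofReal_sub,
      Complex.ofReal_mul, Complex.ofReal_sum]
    rw [h.eq_sum, Fin.sum_univ_succ]
    module
  rw [hA]
  exact ((h₀.smul (h.lam_pos 0).le).add ((IsSeparableMatrix.kronecker
    (posSemidef_of_isStarProjection hV) (posSemidef_of_isStarProjection hW)).smul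
    (sub_nonneg.mpr hle))).add (.sum fun i => (hVW i.succ).smul (h.lam_pos _).le)

theorem isSeparableMatrix_of_posSemidef (h : IsHermitianSchmidtDecomposition A lam γ δ)
    (hw : IsWeakIrreducible A) (hA : IsPPT A) (hγ : (γ 0).PosSemidef) (hδ : (δ 0).PosSemidef)
    (hμ : IsLeastPositiveEigenvalue (γ 0 ⊗ₖ δ 0) μ) (hle : ∑ i : Fin n, lam i.succ ≤ lam 0 * μ) :
    IsSeparableMatrix A := by
  have hγ0 : γ 0 ≠ 0 := fun h0 => by simpa [h0] using h.orthonormal_left 0 0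
  have hδ0 : δ 0 ≠ 0 := fun h0 => by simpa [h0] using h.orthonormal_right 0 0
  obtain ⟨hAV, hAW⟩ := (h.isSchmidtPair 0).mul_supportProjection_kronecker_one
    (Complex.ofReal_ne_zero.mpr (h.lam_pos 0).ne') hw hA hγ hδ hγ0
  exact h.isSeparableMatrix_of_sum_le (isStarProjection_supportProjection _)
    (isStarProjection_supportProjection _) hAV hAW
    (isSeparableMatrix_kronecker_sub_smul_supportProjection hγ hδ hγ0 hδ0 hμ) hle

end IsHermitianSchmidtDecomposition

theorem IsWeakIrreducible.isSeparableMatrix_of_sum_le (hw : IsWeakIrreducible A) (hA : IsPPT A)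
    (h : IsHermitianSchmidtDecomposition A lam γ δ) (hmono : Antitone lam)
    (hμ : IsLeastPositiveEigenvalue (γ 0 ⊗ₖ δ 0) μ) (hle : ∑ i : Fin n, lam i.succ ≤ lam 0 * μ) :
    IsSeparableMatrix A := by
  rcases h.posSemidef_or_posSemidef_neg (fun i => hmono (Fin.zero_le i)) hw hA with
    ⟨hγ, hδ⟩ | ⟨hγ, hδ⟩
  · exact h.isSeparableMatrix_of_posSemidef hw hA hγ hδ hμ hle
  · exact h.neg.isSeparableMatrix_of_posSemidef hw hA hγ hδ (by rwa [neg_kronecker_neg]) hle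

end SeparabilityCriterion

section DiagonalFamily

theorem isLeastPositiveEigenvalue_smul_one {k m : ℕ} [NeZero k] [NeZero m] {c : ℝ} (hc : 0 < c) :
    IsLeastPositiveEigenvalue ((c : ℂ) • (1 : BipartiteMatrix k m)) c := by
  have hiff (x : ℂ) :
      Module.End.HasEigenvalue ((c : ℂ) • (1 : BipartiteMatrix k m)).toLin' x ↔ x = c := by
    rw [Module.End.hasEigenvalue_iff_mem_spectrum, Matrix.spectrum_toLin',
      ← Algebra.algebraMap_eq_smul_one, spectrum.scalar_eq, Set.mem_singleton_iff]
  exact ⟨⟨hc, (hiff c).mpr rfl⟩, fun x hx => (Complex.ofReal_injective ((hiff x).mp hx.2)).ge⟩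

theorem isHermitian_diagonal_ofReal {ι : Type*} [DecidableEq ι] (d : ι → ℝ) :
    (Matrix.diagonal fun i => (d i : ℂ)).IsHermitian :=
  Matrix.isHermitian_diagonal_iff.mpr fun i => Complex.conj_ofReal (d i)

theorem posSemidef_diagonal_ofReal_iff {ι : Type*} [DecidableEq ι] {d : ι → ℝ} :
    (Matrix.diagonal fun i => (d i : ℂ)).PosSemidef ↔ ∀ i, 0 ≤ d i := by
  simp only [Matrix.posSemidef_diagonal_iff, Complex.zero_le_real]

theorem isSeparableMatrix_diagonal_iff {k m : ℕ} {d : Fin k × Fin m → ℝ} :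
    IsSeparableMatrix (Matrix.diagonal fun p => (d p : ℂ)) ↔ ∀ p, 0 ≤ d p := by
  refine ⟨fun h => posSemidef_diagonal_ofReal_iff.mp h.posSemidef, fun hd => ?_⟩
  have hsum : (Matrix.diagonal fun p => (d p : ℂ)) = ∑ i,
      Matrix.diagonal (Pi.single i 1) ⊗ₖ Matrix.diagonal fun j => (d (i, j) : ℂ) := by
    simp only [Matrix.diagonal_kronecker_diagonal]
    ext p q
    simp only [Matrix.sum_apply, Matrix.diagonal_apply]
    split_ifs <;> simp [Pi.single_apply]
  rw [hsum]
  refine .of_fintype (fun i => ?_) fun i => posSemidef_diagonal_ofReal_iff.mpr fun j => hd (i, j)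
  exact Matrix.posSemidef_diagonal_iff.mpr (Pi.single_nonneg.mpr zero_le_one)

theorem trace_diagonal_ofReal_mul {ι : Type*} [Fintype ι] [DecidableEq ι] (d e : ι → ℝ) :
    ((Matrix.diagonal fun i => (d i : ℂ)) * Matrix.diagonal fun i => (e i : ℂ)).trace =
      ((∑ i, d i * e i : ℝ) : ℂ) := by
  simp only [Matrix.diagonal_mul_diagonal, Matrix.trace_diagonal, Complex.ofReal_sum,
    Complex.ofReal_mul]

variable (n : ℕ)

theorem normalizedOne_kronecker_normalizedOne :
    normalizedOne n ⊗ₖ normalizedOne n =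
      ((1 / ((n : ℝ) + 1) : ℝ) : ℂ) • (1 : BipartiteMatrix (n + 1) (n + 1)) := by
  have h : (1 / Real.sqrt (n + 1)) * (1 / Real.sqrt (n + 1)) = 1 / ((n : ℝ) + 1) := by
    rw [div_mul_div_comm, Real.mul_self_sqrt (by positivity), one_mul]
  rw [normalizedOne, Matrix.diagonal_kronecker_diagonal, Matrix.smul_one_eq_diagonal]
  simp only [← Complex.ofReal_mul, h]

theorem isLeastPositiveEigenvalue_normalizedOne :
    IsLeastPositiveEigenvalue (normalizedOne n ⊗ₖ normalizedOne n) (1 / ((n : ℝ) + 1)) := by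
  rw [normalizedOne_kronecker_normalizedOne]
  exact isLeastPositiveEigenvalue_smul_one Nat.one_div_pos_of_nat

theorem isHermitian_normalizedOne : (normalizedOne n).IsHermitian :=
  isHermitian_diagonal_ofReal _

theorem isHermitian_tracelessDiag : (tracelessDiag n).IsHermitian :=
  isHermitian_diagonal_ofReal _

theorem trace_normalizedOne_mul_self : (normalizedOne n * normalizedOne n).trace = 1 := by
  rw [normalizedOne, trace_diagonal_ofReal_mul, Complex.ofReal_eq_one, Finset.sum_const,
    Finset.card_fin, div_mul_div_comm, Real.mul_self_sqrt (by positivity), nsmul_eq_mul,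
    Nat.cast_add_one, one_mul, mul_one_div_cancel (by positivity)]

theorem trace_normalizedOne_mul_tracelessDiag : (normalizedOne n * tracelessDiag n).trace = 0 := by
  rw [normalizedOne, tracelessDiag, trace_diagonal_ofReal_mul, Complex.ofReal_eq_zero,
    ← Finset.mul_sum, ← Finset.sum_div, Fin.sum_univ_succ]
  simp [Fin.succ_ne_zero]

theorem mul_self_sqrt_sq_add : √((n : ℝ) ^ 2 + n) * √((n : ℝ) ^ 2 + n) = (n : ℝ) ^ 2 + n :=
  Real.mul_self_sqrt (by positivity)

variable {n}

theorem trace_tracelessDiag_mul_self (hn : 1 ≤ n) :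
    (tracelessDiag n * tracelessDiag n).trace = 1 := by
  have : (0 : ℝ) < n := Nat.cast_pos.mpr hn
  rw [tracelessDiag, trace_diagonal_ofReal_mul, Complex.ofReal_eq_one]
  simp only [div_mul_div_comm, mul_self_sqrt_sq_add, ← Finset.sum_div]
  rw [div_eq_one_iff_eq (by positivity), Fin.sum_univ_succ]
  simp [Fin.succ_ne_zero, sq]

theorem isOrthonormalFamily_diagFamily_left (hn : 1 ≤ n) :
    IsOrthonormalFamily ![normalizedOne n, tracelessDiag n] := by
  simp [IsOrthonormalFamily, Fin.forall_fin_two, (isHermitian_normalizedOne n).eq,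
    (isHermitian_tracelessDiag n).eq, trace_normalizedOne_mul_self,
    trace_normalizedOne_mul_tracelessDiag,
    Matrix.trace_mul_comm (tracelessDiag n) (normalizedOne n), trace_tracelessDiag_mul_self hn]

theorem isOrthonormalFamily_diagFamily_right (hn : 1 ≤ n) :
    IsOrthonormalFamily ![normalizedOne n, -tracelessDiag n] := by
  simpa [IsOrthonormalFamily, Fin.forall_fin_two] using isOrthonormalFamily_diagFamily_left hn

theorem isHermitianSchmidtDecomposition_diagFamily (hn : 1 ≤ n) {lam₁ lam₂ : ℝ} (h₁ : 0 < lam₁)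
    (h₂ : 0 < lam₂) :
    IsHermitianSchmidtDecomposition (diagFamily n lam₁ lam₂) ![lam₁, lam₂]
      ![normalizedOne n, tracelessDiag n] ![normalizedOne n, -tracelessDiag n] where
  lam_pos := Fin.forall_fin_two.mpr ⟨h₁, h₂⟩
  hermitian_left := Fin.forall_fin_two.mpr
    ⟨isHermitian_normalizedOne n, isHermitian_tracelessDiag n⟩
  hermitian_right := Fin.forall_fin_two.mpr
    ⟨isHermitian_normalizedOne n, (isHermitian_tracelessDiag n).neg⟩
  orthonormal_left := isOrthonormalFamily_diagFamily_left hn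
  orthonormal_right := isOrthonormalFamily_diagFamily_right hn
  eq_sum := by
    rw [Fin.sum_univ_two]
    rfl

/-- The diagonal `(n, -1, …, -1)` of `√(n² + n) • tracelessDiag n`. -/
def tracelessVec (n : ℕ) (i : Fin (n + 1)) : ℝ := if i = 0 then n else -1

theorem tracelessVec_mul_le (hn : 1 ≤ n) (i j : Fin (n + 1)) :
    tracelessVec n i * tracelessVec n j ≤ (n : ℝ) ^ 2 := by
  have hn' : (1 : ℝ) ≤ n := Nat.one_le_cast.mpr hn
  unfold tracelessVec
  split_ifs <;> nlinarith

theorem diagFamily_eq_diagonal (n : ℕ) (lam₁ lam₂ : ℝ) :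
    diagFamily n lam₁ lam₂ = Matrix.diagonal fun p =>
      ((lam₁ * (1 / ((n : ℝ) + 1)) -
        tracelessVec n p.1 * tracelessVec n p.2 / ((n : ℝ) ^ 2 + n) * lam₂ : ℝ) : ℂ) := by
  rw [diagFamily, normalizedOne_kronecker_normalizedOne, tracelessDiag, Matrix.diagonal_neg,
    Matrix.diagonal_kronecker_diagonal, Matrix.smul_one_eq_diagonal, ← Matrix.diagonal_smul,
    ← Matrix.diagonal_smul, Matrix.diagonal_add]
  congr 1
  ext p
  have hdiv : tracelessVec n p.1 * tracelessVec n p.2 / ((n : ℝ) ^ 2 + n) =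
      tracelessVec n p.1 / √((n : ℝ) ^ 2 + n) * (tracelessVec n p.2 / √((n : ℝ) ^ 2 + n)) := by
    rw [div_mul_div_comm, mul_self_sqrt_sq_add]
  rw [hdiv]
  simp only [tracelessVec, Pi.smul_apply, smul_eq_mul, Complex.ofReal_sub, Complex.ofReal_mul]
  ring

theorem isSeparableMatrix_diagFamily_iff (hn : 1 ≤ n) {lam₁ lam₂ : ℝ} (h₂ : 0 < lam₂) :
    IsSeparableMatrix (diagFamily n lam₁ lam₂) ↔
      (n : ℝ) ^ 2 / ((n : ℝ) ^ 2 + n) ≤ lam₁ * (1 / ((n : ℝ) + 1)) / lam₂ := by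
  rw [diagFamily_eq_diagonal, isSeparableMatrix_diagonal_iff, le_div_iff₀ h₂]
  simp only [sub_nonneg]
  refine ⟨fun h => ?_, fun h p => le_trans ?_ h⟩
  · simpa only [tracelessVec, if_true, ← sq] using h (0, 0)
  · gcongr
    exact tracelessVec_mul_le hn p.1 p.2

theorem exists_lt_sq_div (l : ℝ) (hl : l < 1) :
    ∃ n : ℕ, 1 ≤ n ∧ l < (n : ℝ) ^ 2 / ((n : ℝ) ^ 2 + n) := by
  obtain ⟨n, hn⟩ := exists_nat_gt (1 / (1 - l))
  have hl' : 0 < 1 - l := sub_pos.mpr hl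
  have hn0 : (0 : ℝ) < n := (one_div_pos.mpr hl').trans hn
  refine ⟨n, Nat.cast_pos.mp hn0, ?_⟩
  rw [div_lt_iff₀ hl'] at hn
  rw [lt_div_iff₀ (by positivity)]
  nlinarith

end DiagonalFamily

section RangeCriterion

variable {k m : ℕ}

theorem IsSeparableMatrix.exists_vectors {A : BipartiteMatrix k m} (hA : IsSeparableMatrix A) :
    ∃ (N : ℕ) (x : Fin N → Fin k → ℂ) (y : Fin N → Fin m → ℂ), ∀ p q,
      A p q = ∑ t, x t p.1 * star (x t q.1) * (y t p.2 * star (y t q.2)) := by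
  obtain ⟨n, C, D, hC, hD, rfl⟩ := hA
  choose a u hu using fun i => Matrix.posSemidef_iff_eq_sum_vecMulVec.mp (hC i)
  choose b v hv using fun i => Matrix.posSemidef_iff_eq_sum_vecMulVec.mp (hD i)
  let e := Fintype.equivFin (Σ i, Fin (a i) × Fin (b i))
  refine ⟨_, fun t => u (e.symm t).1 (e.symm t).2.1, fun t => v (e.symm t).1 (e.symm t).2.2, ?_⟩
  intro p q
  rw [Equiv.sum_comp e.symm fun s => u s.1 s.2.1 p.1 * star (u s.1 s.2.1 q.1) *
    (v s.1 s.2.2 p.2 * star (v s.1 s.2.2 q.2)), Fintype.sum_sigma, Matrix.sum_apply]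
  refine Finset.sum_congr rfl fun i _ => ?_
  rw [Matrix.kroneckerMap_apply, hu i, hv i, Matrix.sum_apply, Matrix.sum_apply,
    Finset.sum_mul_sum, Fintype.sum_prod_type]
  rfl

theorem eq_mul_of_sum_mul_star {ι : Type*} [Fintype ι] {u v : ι → ℂ} {r : ℝ}
    (huu : ∑ t, u t * star (u t) = (r : ℂ) ^ 2) (hvv : ∑ t, v t * star (v t) = 1)
    (huv : ∑ t, u t * star (v t) = r) (t : ι) : u t = r * v t := by
  have hvu : ∑ t, v t * star (u t) = r := by
    calc ∑ t, v t * star (u t) = star (∑ t, u t * star (v t)) := by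
          simp only [star_sum, star_mul, star_star]
      _ = r := by rw [huv, Complex.star_def, Complex.conj_ofReal]
  have hsum : ∑ t, (u t - r * v t) * star (u t - r * v t) = 0 := by
    calc ∑ t, (u t - r * v t) * star (u t - r * v t)
        = ∑ t, u t * star (u t) - r * ∑ t, u t * star (v t) - r * ∑ t, v t * star (u t) +
            r ^ 2 * ∑ t, v t * star (v t) := by
          simp only [Finset.mul_sum, ← Finset.sum_sub_distrib, ← Finset.sum_add_distrib]
          refine Finset.sum_congr rfl fun t _ => ?_
          simp only [star_sub, star_mul', Complex.star_def, Complex.conj_ofReal]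
          ring
      _ = 0 := by rw [huu, hvv, huv, hvu]; ring
  rw [Finset.sum_eq_zero_iff_of_nonneg fun t _ => mul_star_self_nonneg _] at hsum
  exact sub_eq_zero.mp (CStarRing.mul_star_self_eq_zero_iff _ |>.mp (hsum t (Finset.mem_univ t)))

theorem two_mul_norm_mul_norm_le {a b c d : ℂ} (h : ‖a * b‖ = ‖c * d‖) :
    2 * ‖a * b‖ ^ 2 ≤ ‖a * d‖ ^ 2 + ‖c * b‖ ^ 2 := by
  have hprod : ‖a * b‖ * ‖c * d‖ = ‖a * d‖ * ‖c * b‖ := by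
    simp only [norm_mul]
    ring
  calc 2 * ‖a * b‖ ^ 2 = 2 * ‖a * d‖ * ‖c * b‖ := by rw [mul_assoc, ← hprod, ← h, sq]
    _ ≤ ‖a * d‖ ^ 2 + ‖c * b‖ ^ 2 := two_mul_le_add_sq _ _

/-- The hypotheses say that `E_ii - r E_jj` lies in the kernel of the sesquilinear form of `A`
and `E_li - r E_il` in that of its partial transpose. -/
theorem IsSeparableMatrix.two_le_re {A : BipartiteMatrix k k} (hA : IsSeparableMatrix A)
    {i j l : Fin k} {r : ℝ} (hr : r ≠ 0) (hii : A (i, i) (i, i) = (r : ℂ) ^ 2)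
    (hjj : A (j, j) (j, j) = 1) (hll : A (l, l) (l, l) = 1)
    (hij : A (i, i) (j, j) = r) (hli : A (l, i) (i, l) = r) :
    2 ≤ (A (j, l) (j, l)).re + (A (l, j) (l, j)).re := by
  obtain ⟨N, x, y, h⟩ := hA.exists_vectors
  have hj (t) : x t i * y t i = r * (x t j * y t j) := by
    refine eq_mul_of_sum_mul_star (u := fun t => x t i * y t i) (v := fun t => x t j * y t j)
      (.trans ?_ hii) (.trans ?_ hjj) (.trans ?_ hij) t <;>
      simp only [h, star_mul', mul_mul_mul_comm]
  have hl (t) : star (x t i) * y t i = r * (star (x t l) * y t l) := by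
    refine eq_mul_of_sum_mul_star (u := fun t => star (x t i) * y t i)
      (v := fun t => star (x t l) * y t l) (.trans ?_ hii) (.trans ?_ hll) (.trans ?_ hli) t <;>
      simp only [h, star_mul', star_star, mul_mul_mul_comm, mul_comm (star (x _ _)) (x _ _)]
  have hnorm (t) : ‖x t j * y t j‖ = ‖x t l * y t l‖ := by
    have hr' : ‖(r : ℂ)‖ ≠ 0 := norm_ne_zero_iff.mpr (Complex.ofReal_ne_zero.mpr hr)
    refine mul_left_cancel₀ hr' ?_
    rw [← norm_mul, ← hj, norm_mul, ← norm_star, ← norm_mul, hl]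
    simp only [norm_mul, norm_star]
  have hdiag (a b) : (A (a, b) (a, b)).re = ∑ t, ‖x t a * y t b‖ ^ 2 := by
    rw [h, Complex.re_sum]
    refine Finset.sum_congr rfl fun t _ => ?_
    simp only [Complex.star_def, Complex.mul_conj', ← Complex.ofReal_pow, ← Complex.ofReal_mul,
      Complex.ofReal_re, norm_mul, mul_pow]
  calc 2 = 2 * (A (j, j) (j, j)).re := by rw [hjj, Complex.one_re, mul_one]
    _ = ∑ t, 2 * ‖x t j * y t j‖ ^ 2 := by rw [hdiag, Finset.mul_sum]
    _ ≤ ∑ t, (‖x t j * y t l‖ ^ 2 + ‖x t l * y t j‖ ^ 2) :=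
      Finset.sum_le_sum fun t _ => two_mul_norm_mul_norm_le (hnorm t)
    _ = (A (j, l) (j, l)).re + (A (l, j) (l, j)).re := by
      rw [hdiag, hdiag, Finset.sum_add_distrib]

end RangeCriterion

section PartialTransposeLinear

variable {k m : ℕ}

theorem partialTranspose_add (A B : BipartiteMatrix k m) :
    partialTranspose (A + B) = partialTranspose A + partialTranspose B := rfl

theorem partialTranspose_smul (c : ℂ) (A : BipartiteMatrix k m) :
    partialTranspose (c • A) = c • partialTranspose A := rfl

theorem partialTranspose_diagonal (d : Fin k × Fin m → ℂ) :
    partialTranspose (Matrix.diagonal d) = Matrix.diagonal d := by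
  ext ⟨a, b⟩ ⟨c, e⟩
  by_cases h : a = c
  · subst h
    rfl
  · simp [partialTranspose, Matrix.diagonal_apply, h, Ne.symm h]

theorem partialTranspose_single (a c : Fin k) (b e : Fin m) :
    partialTranspose (Matrix.single (a, b) (c, e) (1 : ℂ)) = Matrix.single (c, b) (a, e) 1 := by
  simpa only [Matrix.single_kronecker_single, Matrix.transpose_single, mul_one] using
    partialTranspose_kronecker (Matrix.single a c (1 : ℂ)) (Matrix.single b e (1 : ℂ))

end PartialTransposeLinear

section Coupling

/-- The Hermitian matrix `E_pq + E_qp`, which couples the basis vectors `p` and `q`. -/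
def coupling {ι : Type*} [DecidableEq ι] (p q : ι) : Matrix ι ι ℂ :=
  Matrix.single p q 1 + Matrix.single q p 1

theorem partialTranspose_coupling {k m : ℕ} (a c : Fin k) (b e : Fin m) :
    partialTranspose (coupling (a, b) (c, e)) = coupling (c, b) (a, e) := by
  simp only [coupling, partialTranspose_add, partialTranspose_single]

variable {ι : Type*} [DecidableEq ι]

theorem isHermitian_coupling (p q : ι) : (coupling p q).IsHermitian := by
  simp only [Matrix.IsHermitian, coupling, Matrix.conjTranspose_add, Matrix.conjTranspose_single,
    star_one, add_comm]

theorem coupling_apply_self {p q : ι} (hpq : p ≠ q) (s : ι) : coupling p q s s = 0 := by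
  simp only [coupling, Matrix.add_apply, Matrix.single_apply]
  grind

variable [Fintype ι]

theorem coupling_mulVec (p q : ι) (v : ι → ℂ) :
    (coupling p q).mulVec v = Pi.single p (v q) + Pi.single q (v p) := by
  simp only [coupling, Matrix.add_mulVec, Matrix.single_mulVec, one_mul, Pi.single]

theorem star_dotProduct_coupling_mulVec (p q : ι) (v : ι → ℂ) :
    star v ⬝ᵥ (coupling p q).mulVec v = ((2 * (star (v p) * v q).re : ℝ) : ℂ) := by
  rw [coupling_mulVec, dotProduct_add, dotProduct_single, dotProduct_single, Complex.ofReal_mul,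
    Complex.re_eq_add_conj]
  simp only [Pi.star_apply, Complex.star_def, map_mul, Complex.conj_conj, Complex.ofReal_ofNat]
  ring

theorem neg_add_le_mul_two_mul_re {a b c : ℝ} (ha : 0 ≤ a) (hb : 0 ≤ b) (hc : c ^ 2 ≤ a * b)
    (z w : ℂ) : -(a * ‖z‖ ^ 2 + b * ‖w‖ ^ 2) ≤ c * (2 * (star z * w).re) := by
  have hre : (star z * w).re ^ 2 ≤ ‖z‖ ^ 2 * ‖w‖ ^ 2 := by
    simpa only [norm_mul, norm_star, mul_pow, sq_abs] using
      pow_le_pow_left₀ (abs_nonneg _) (Complex.abs_re_le_norm (star z * w)) 2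
  refine (abs_le_of_sq_le_sq' ?_ (by positivity)).1
  calc (c * (2 * (star z * w).re)) ^ 2 = 4 * (c ^ 2 * (star z * w).re ^ 2) := by ring
    _ ≤ 4 * (a * b * (‖z‖ ^ 2 * ‖w‖ ^ 2)) := by gcongr
    _ = 4 * (a * ‖z‖ ^ 2) * (b * ‖w‖ ^ 2) := by ring
    _ ≤ (a * ‖z‖ ^ 2 + b * ‖w‖ ^ 2) ^ 2 := four_mul_le_sq_add _ _

end Coupling

section PosSemidefCoupling

variable {ι : Type*} [Finite ι] [DecidableEq ι]

theorem posSemidef_diagonal_add_smul_coupling {d : ι → ℝ} {c : ℝ} {p q : ι} (hpq : p ≠ q)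
    (hd : ∀ i, 0 ≤ d i) (hc : c ^ 2 ≤ d p * d q) :
    ((Matrix.diagonal fun i => (d i : ℂ)) + (c : ℂ) • coupling p q).PosSemidef := by
  have := Fintype.ofFinite ι
  have hform (v : ι → ℂ) : star v ⬝ᵥ
      ((Matrix.diagonal fun i => (d i : ℂ)) + (c : ℂ) • coupling p q).mulVec v =
        ((∑ i, d i * ‖v i‖ ^ 2 + c * (2 * (star (v p) * v q).re) : ℝ) : ℂ) := by
    rw [Matrix.add_mulVec, dotProduct_add, Matrix.smul_mulVec, dotProduct_smul,
      star_dotProduct_coupling_mulVec, smul_eq_mul, ← Complex.ofReal_mul, Complex.ofReal_add,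
      Complex.ofReal_sum]
    congr 1
    refine Finset.sum_congr rfl fun i _ => ?_
    rw [Matrix.mulVec_diagonal, Complex.ofReal_mul, Complex.ofReal_pow, ← Complex.conj_mul',
      Pi.star_apply, Complex.star_def, mul_left_comm]
  refine .of_dotProduct_mulVec_nonneg ?_ fun v => ?_
  · exact (isHermitian_diagonal_ofReal d).add ((isHermitian_coupling p q).smul
      (Complex.conj_ofReal c))
  · have hsum : d p * ‖v p‖ ^ 2 + d q * ‖v q‖ ^ 2 ≤ ∑ i, d i * ‖v i‖ ^ 2 := by
      rw [← Finset.sum_pair (f := fun i => d i * ‖v i‖ ^ 2) hpq]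
      exact Finset.sum_le_univ_sum_of_nonneg fun i => mul_nonneg (hd i) (sq_nonneg _)
    rw [hform, Complex.zero_le_real]
    linarith [neg_add_le_mul_two_mul_re (hd p) (hd q) hc (v p) (v q)]

theorem posSemidef_diagonal_add_smul_coupling_add {d : ι → ℝ} {c : ℝ} {p q p' q' : ι}
    (hpq : p ≠ q) (hpq' : p' ≠ q') (hp : p' ≠ p ∧ p' ≠ q) (hq : q' ≠ p ∧ q' ≠ q)
    (hd : ∀ i, 0 ≤ d i) (hc : c ^ 2 ≤ d p * d q) (hc' : c ^ 2 ≤ d p' * d q') :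
    ((Matrix.diagonal fun i => (d i : ℂ)) + (c : ℂ) • coupling p q +
      (c : ℂ) • coupling p' q').PosSemidef := by
  let f (i : ι) : ℝ := if i = p ∨ i = q then d i else 0
  let g (i : ι) : ℝ := if i = p ∨ i = q then 0 else d i
  have hf (i : ι) : 0 ≤ f i := ite_nonneg (hd i) le_rfl
  have hg (i : ι) : 0 ≤ g i := ite_nonneg le_rfl (hd i)
  have hcf : c ^ 2 ≤ f p * f q := by simpa only [f, true_or, or_true, if_true] using hc
  have hcg : c ^ 2 ≤ g p' * g q' := by simpa only [g, hp, hq, or_self, if_false] using hc'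
  have hfg : (Matrix.diagonal fun i => (d i : ℂ)) =
      (Matrix.diagonal fun i => (f i : ℂ)) + Matrix.diagonal fun i => (g i : ℂ) := by
    rw [Matrix.diagonal_add]
    congr 1
    ext i
    simp only [f, g]
    split_ifs <;> simp only [Complex.ofReal_zero, add_zero, zero_add]
  rw [hfg, add_assoc, add_add_add_comm]
  exact (posSemidef_diagonal_add_smul_coupling hpq hf hcf).add
    (posSemidef_diagonal_add_smul_coupling hpq' hg hcg)

end PosSemidefCoupling

section WeakIrreducibleOfKernel

variable {k m : ℕ} {A : BipartiteMatrix k m}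

theorem eq_zero_or_eq_zero_of_mul_kronecker_eq_zero
    (h : ∀ (x : Fin k → ℂ) (y : Fin m → ℂ), A.mulVec (fun p => x p.1 * y p.2) = 0 → x = 0 ∨ y = 0)
    {V : Matrix (Fin k) (Fin k) ℂ} {W : Matrix (Fin m) (Fin m) ℂ} (hVW : A * (V ⊗ₖ W) = 0) :
    V = 0 ∨ W = 0 := by
  rw [or_iff_not_imp_left]
  intro hV
  obtain ⟨a, ha⟩ := Function.ne_iff.mp (mt Matrix.transpose_eq_zero.mp hV)
  refine Matrix.ext fun j b => congrFun ((h (fun i => V i a) (fun j => W j b) ?_).resolve_left ha) j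
  exact funext fun p => congrFun (congrFun hVW p) (a, b)

theorem isWeakIrreducible_of_no_product_kernel (hA : A.PosSemidef)
    (h : ∀ (x : Fin k → ℂ) (y : Fin m → ℂ), A.mulVec (fun p => x p.1 * y p.2) = 0 →
      x = 0 ∨ y = 0) : IsWeakIrreducible A := by
  refine ⟨hA, fun V₁ V₂ W₁ W₂ hV₁ hV₂ _ _ hV hW _ _ hs => ?_⟩
  have hV' : V₂ * V₁ = 0 := by
    rw [← hV₂.1.eq, ← hV₁.1.eq, ← Matrix.conjTranspose_mul, hV, Matrix.conjTranspose_zero]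
  have hcross : A * (V₁ ⊗ₖ W₂) = 0 := by
    rw [hs, Matrix.add_mul, Matrix.mul_assoc _ (V₁ ⊗ₖ W₁), Matrix.mul_assoc _ (V₂ ⊗ₖ W₂),
      ← Matrix.mul_kronecker_mul, ← Matrix.mul_kronecker_mul, hW, hV', Matrix.kronecker_zero,
      Matrix.zero_kronecker, Matrix.mul_zero, Matrix.mul_zero, add_zero]
  rcases eq_zero_or_eq_zero_of_mul_kronecker_eq_zero h hcross with hV₁0 | hW₂0
  · left
    rw [hV₁0, Matrix.zero_kronecker, Matrix.mul_zero]
  · right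
    rw [hW₂0, Matrix.kronecker_zero, Matrix.mul_zero]

end WeakIrreducibleOfKernel

section EntangledMatrix

/-- The diagonal of `E_pp - E_qq`. -/
def differenceVec {ι : Type*} [DecidableEq ι] (p q : ι) : ι → ℝ := Pi.single p 1 - Pi.single q 1

theorem differenceVec_swap {ι : Type*} [DecidableEq ι] (p q : ι) :
    differenceVec p q = -differenceVec q p := (neg_sub _ _).symm

theorem neg_one_le_differenceVec_mul {ι : Type*} [DecidableEq ι] (p q i j : ι) :
    -1 ≤ differenceVec p q i * differenceVec p q j := by
  simp only [differenceVec, Pi.sub_apply, Pi.single_apply]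
  split_ifs <;> norm_num

variable {n : ℕ}

/-- The diagonal of `entangledMatrix`. -/
def entangledDiag (e₁ e₂ : Fin (n + 1)) (d : ℝ) (p : Fin (n + 1) × Fin (n + 1)) : ℝ :=
  1 - d * (tracelessVec n p.1 * tracelessVec n p.2) +
    d * (differenceVec e₁ e₂ p.1 * differenceVec e₁ e₂ p.2)

/-- A perturbation of `1 - E₀₀ ⊗ E₀₀`, which for `d n² = 1 - r²` is an entangled PPT matrix whose
product kernel is trivial. Partial transposition interchanges `e₁` and `e₂`. -/
def entangledMatrix (e₁ e₂ : Fin (n + 1)) (d r : ℝ) : BipartiteMatrix (n + 1) (n + 1) :=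
  (Matrix.diagonal fun p => (entangledDiag e₁ e₂ d p : ℂ)) +
    (r : ℂ) • coupling (0, 0) (e₁, e₁) + (r : ℂ) • coupling (e₂, 0) (0, e₂)

variable {e₁ e₂ : Fin (n + 1)} {d r : ℝ}

theorem entangledDiag_swap : entangledDiag e₁ e₂ d = entangledDiag e₂ e₁ d := by
  ext p
  simp only [entangledDiag, differenceVec_swap e₁ e₂, Pi.neg_apply, neg_mul_neg]

theorem partialTranspose_entangledMatrix :
    partialTranspose (entangledMatrix e₁ e₂ d r) = entangledMatrix e₂ e₁ d r := by
  simp only [entangledMatrix, partialTranspose_add, partialTranspose_smul,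
    partialTranspose_diagonal, partialTranspose_coupling, entangledDiag_swap (e₁ := e₁)]
  rw [add_right_comm]

theorem entangledDiag_pos (hn : 2 ≤ n) (hd0 : 0 < d) (hd : d * n ^ 2 = 1 - r ^ 2)
    {p : Fin (n + 1) × Fin (n + 1)} (hp : p ≠ (0, 0)) : 0 < entangledDiag e₁ e₂ d p := by
  have hn' : (2 : ℝ) ≤ n := Nat.ofNat_le_cast.mpr hn
  have hd4 : d * 4 ≤ d * n ^ 2 := mul_le_mul_of_nonneg_left (by nlinarith) hd0.le
  have htraceless : tracelessVec n p.1 * tracelessVec n p.2 ≤ 1 := by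
    unfold tracelessVec
    split_ifs with h₁ h₂
    · exact absurd (Prod.ext h₁ h₂) hp
    all_goals linarith
  have hdifference := neg_one_le_differenceVec_mul e₁ e₂ p.1 p.2
  unfold entangledDiag
  linarith [mul_le_mul_of_nonneg_left hdifference hd0.le,
    mul_le_mul_of_nonneg_left htraceless hd0.le, sq_nonneg r]

theorem entangledDiag_zero_zero (h₁ : e₁ ≠ 0) (h₂ : e₂ ≠ 0) (hd : d * n ^ 2 = 1 - r ^ 2) :
    entangledDiag e₁ e₂ d (0, 0) = r ^ 2 := by
  simp only [entangledDiag, tracelessVec, differenceVec, Pi.sub_apply, Pi.single_apply, h₁.symm,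
    h₂.symm, if_true, if_false]
  linarith

theorem entangledDiag_left (h₁ : e₁ ≠ 0) (h₁₂ : e₁ ≠ e₂) :
    entangledDiag e₁ e₂ d (e₁, e₁) = 1 := by
  simp [entangledDiag, tracelessVec, differenceVec, h₁, h₁₂]

theorem entangledDiag_right (h₂ : e₂ ≠ 0) (h₁₂ : e₁ ≠ e₂) :
    entangledDiag e₁ e₂ d (e₂, e₂) = 1 := by
  rw [entangledDiag_swap, entangledDiag_left h₂ h₁₂.symm]

theorem entangledDiag_left_right (h₁ : e₁ ≠ 0) (h₂ : e₂ ≠ 0) (h₁₂ : e₁ ≠ e₂) :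
    entangledDiag e₁ e₂ d (e₁, e₂) = 1 - 2 * d := by
  have hdifference : differenceVec e₁ e₂ e₁ * differenceVec e₁ e₂ e₂ = -1 := by
    simp [differenceVec, h₁₂, h₁₂.symm]
  rw [entangledDiag, hdifference, tracelessVec, tracelessVec, if_neg h₁, if_neg h₂]
  ring

theorem entangledDiag_fst_zero (h₁ : e₁ ≠ 0) (h₂ : e₂ ≠ 0) {i : Fin (n + 1)} (hi : i ≠ 0) :
    entangledDiag e₁ e₂ d (i, 0) = 1 + d * n := by
  simp [entangledDiag, tracelessVec, differenceVec, h₁.symm, h₂.symm, hi]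

theorem entangledDiag_zero_snd (h₁ : e₁ ≠ 0) (h₂ : e₂ ≠ 0) {i : Fin (n + 1)} (hi : i ≠ 0) :
    entangledDiag e₁ e₂ d (0, i) = 1 + d * n := by
  simp [entangledDiag, tracelessVec, differenceVec, h₁.symm, h₂.symm, hi]

theorem posSemidef_entangledMatrix (h₁ : e₁ ≠ 0) (h₂ : e₂ ≠ 0) (h₁₂ : e₁ ≠ e₂) (hn : 2 ≤ n)
    (hd0 : 0 < d) (hd : d * n ^ 2 = 1 - r ^ 2) : (entangledMatrix e₁ e₂ d r).PosSemidef := by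
  have hnonneg (p : Fin (n + 1) × Fin (n + 1)) : 0 ≤ entangledDiag e₁ e₂ d p := by
    rcases eq_or_ne p (0, 0) with rfl | hp
    · rw [entangledDiag_zero_zero h₁ h₂ hd]
      exact sq_nonneg r
    · exact (entangledDiag_pos hn hd0 hd hp).le
  refine posSemidef_diagonal_add_smul_coupling_add ?_ ?_ ?_ ?_ hnonneg ?_ ?_
  · simp [h₁.symm]
  · simp [h₂]
  · simp [h₂, h₁.symm]
  · simp [h₂, h₁.symm]
  · rw [entangledDiag_zero_zero h₁ h₂ hd, entangledDiag_left h₁ h₁₂, mul_one]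
  · rw [entangledDiag_fst_zero h₁ h₂ h₂, entangledDiag_zero_snd h₁ h₂ h₂]
    nlinarith [mul_nonneg hd0.le n.cast_nonneg, mul_nonneg hd0.le (sq_nonneg (n : ℝ))]

theorem isPPT_entangledMatrix (h₁ : e₁ ≠ 0) (h₂ : e₂ ≠ 0) (h₁₂ : e₁ ≠ e₂) (hn : 2 ≤ n)
    (hd0 : 0 < d) (hd : d * n ^ 2 = 1 - r ^ 2) : IsPPT (entangledMatrix e₁ e₂ d r) :=
  ⟨posSemidef_entangledMatrix h₁ h₂ h₁₂ hn hd0 hd, by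
    rw [partialTranspose_entangledMatrix]
    exact posSemidef_entangledMatrix h₂ h₁ h₁₂.symm hn hd0 hd⟩

theorem entangledMatrix_apply_self (h₁ : e₁ ≠ 0) (h₂ : e₂ ≠ 0)
    (p : Fin (n + 1) × Fin (n + 1)) :
    entangledMatrix e₁ e₂ d r p p = entangledDiag e₁ e₂ d p := by
  have h₁' : ((0, 0) : Fin (n + 1) × Fin (n + 1)) ≠ (e₁, e₁) := by simp [h₁.symm]
  have h₂' : ((e₂, 0) : Fin (n + 1) × Fin (n + 1)) ≠ (0, e₂) := by simp [h₂]
  simp only [entangledMatrix, Matrix.add_apply, Matrix.smul_apply, Matrix.diagonal_apply_eq,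
    coupling_apply_self h₁', coupling_apply_self h₂', smul_zero, add_zero]

theorem entangledMatrix_apply_zero_left (h₁ : e₁ ≠ 0) :
    entangledMatrix e₁ e₂ d r (0, 0) (e₁, e₁) = r := by
  simp [entangledMatrix, coupling, h₁, h₁.symm]

theorem entangledMatrix_apply_right_zero (h₁ : e₁ ≠ 0) (h₂ : e₂ ≠ 0) :
    entangledMatrix e₁ e₂ d r (e₂, 0) (0, e₂) = r := by
  simp [entangledMatrix, coupling, h₁, h₂, h₂.symm]

theorem not_isSeparableMatrix_entangledMatrix (h₁ : e₁ ≠ 0) (h₂ : e₂ ≠ 0) (h₁₂ : e₁ ≠ e₂)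
    (hr : r ≠ 0) (hd0 : 0 < d) (hd : d * n ^ 2 = 1 - r ^ 2) :
    ¬ IsSeparableMatrix (entangledMatrix e₁ e₂ d r) := by
  intro h
  have hself := entangledMatrix_apply_self (d := d) (r := r) h₁ h₂
  have htwo : 2 ≤ (1 - 2 * d) + (1 - 2 * d) := by
    convert h.two_le_re hr ?_ ?_ ?_ (entangledMatrix_apply_zero_left h₁)
      (entangledMatrix_apply_right_zero h₁ h₂) using 2
    · rw [hself, entangledDiag_left_right h₁ h₂ h₁₂, Complex.ofReal_re]
    · rw [hself, entangledDiag_swap, entangledDiag_left_right h₂ h₁ h₁₂.symm, Complex.ofReal_re]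
    · rw [hself, entangledDiag_zero_zero h₁ h₂ hd, Complex.ofReal_pow]
    · rw [hself, entangledDiag_left h₁ h₁₂, Complex.ofReal_one]
    · rw [hself, entangledDiag_right h₂ h₁₂, Complex.ofReal_one]
  linarith

theorem entangledMatrix_mulVec_apply (v : Fin (n + 1) × Fin (n + 1) → ℂ)
    (p : Fin (n + 1) × Fin (n + 1)) :
    (entangledMatrix e₁ e₂ d r).mulVec v p = entangledDiag e₁ e₂ d p * v p +
      r * (Pi.single (0, 0) (v (e₁, e₁)) + Pi.single (e₁, e₁) (v (0, 0)) : _ → ℂ) p +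
      r * (Pi.single (e₂, 0) (v (0, e₂)) + Pi.single (0, e₂) (v (e₂, 0)) : _ → ℂ) p := by
  simp only [entangledMatrix, Matrix.add_mulVec, Matrix.smul_mulVec, coupling_mulVec,
    Matrix.mulVec_diagonal, Pi.add_apply, Pi.smul_apply, smul_eq_mul]

theorem add_mul_eq_zero_of_entangledMatrix_mulVec_eq_zero (h₁ : e₁ ≠ 0) (h₁₂ : e₁ ≠ e₂)
    {v : Fin (n + 1) × Fin (n + 1) → ℂ} (hv : (entangledMatrix e₁ e₂ d r).mulVec v = 0) :
    v (e₁, e₁) + r * v (0, 0) = 0 := by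
  simpa [entangledMatrix_mulVec_apply, entangledDiag_left h₁ h₁₂, h₁, Pi.single_apply] using
    congrFun hv (e₁, e₁)

theorem eq_zero_of_sq_ne_sq {K : Type*} [Field K] {a b u v : K} (hab : a ^ 2 ≠ b ^ 2)
    (h₁ : a * u + b * v = 0) (h₂ : a * v + b * u = 0) : u = 0 :=
  (mul_eq_zero.mp (by linear_combination a * h₁ - b * h₂ : (a ^ 2 - b ^ 2) * u = 0)).resolve_left
    (sub_ne_zero.mpr hab)

theorem eq_zero_of_entangledMatrix_mulVec_eq_zero (h₁ : e₁ ≠ 0) (h₂ : e₂ ≠ 0) (hn : 2 ≤ n)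
    (hd0 : 0 < d) (hd : d * n ^ 2 = 1 - r ^ 2)
    {v : Fin (n + 1) × Fin (n + 1) → ℂ} (hv : (entangledMatrix e₁ e₂ d r).mulVec v = 0)
    {p : Fin (n + 1) × Fin (n + 1)} (hp0 : p ≠ (0, 0)) (hp1 : p ≠ (e₁, e₁)) : v p = 0 := by
  have hdet : ((1 + d * n : ℝ) : ℂ) ^ 2 ≠ (r : ℂ) ^ 2 := by
    have hdn : 0 < d * n := mul_pos hd0 (Nat.cast_pos.mpr (by omega))
    have hr : r ^ 2 < (1 + d * n) ^ 2 := by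
      nlinarith [mul_nonneg hd0.le (sq_nonneg (n : ℝ))]
    exact_mod_cast hr.ne'
  have hfst : ((1 + d * n : ℝ) : ℂ) * v (e₂, 0) + r * v (0, e₂) = 0 := by
    simpa [entangledMatrix_mulVec_apply, entangledDiag_fst_zero h₁ h₂ h₂, h₂, h₁.symm,
      Pi.single_apply] using congrFun hv (e₂, 0)
  have hsnd : ((1 + d * n : ℝ) : ℂ) * v (0, e₂) + r * v (e₂, 0) = 0 := by
    simpa [entangledMatrix_mulVec_apply, entangledDiag_zero_snd h₁ h₂ h₂, h₂, h₁.symm,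
      Pi.single_apply] using congrFun hv (0, e₂)
  by_cases hp2 : p = (e₂, 0)
  · exact hp2 ▸ eq_zero_of_sq_ne_sq hdet hfst hsnd
  by_cases hp3 : p = (0, e₂)
  · exact hp3 ▸ eq_zero_of_sq_ne_sq hdet hsnd hfst
  have hdiag : (entangledDiag e₁ e₂ d p : ℂ) * v p = 0 := by
    have h := congrFun hv p
    rwa [entangledMatrix_mulVec_apply, Pi.add_apply, Pi.add_apply, Pi.single_eq_of_ne hp0,
      Pi.single_eq_of_ne hp1, Pi.single_eq_of_ne hp2, Pi.single_eq_of_ne hp3, add_zero, mul_zero,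
      add_zero, add_zero] at h
  exact (mul_eq_zero.mp hdiag).resolve_left
    (Complex.ofReal_ne_zero.mpr (entangledDiag_pos hn hd0 hd hp0).ne')

theorem isWeakIrreducible_entangledMatrix (h₁ : e₁ ≠ 0) (h₂ : e₂ ≠ 0) (h₁₂ : e₁ ≠ e₂)
    (hn : 2 ≤ n) (hr : r ≠ 0) (hd0 : 0 < d) (hd : d * n ^ 2 = 1 - r ^ 2) :
    IsWeakIrreducible (entangledMatrix e₁ e₂ d r) := by
  refine isWeakIrreducible_of_no_product_kernel
    (posSemidef_entangledMatrix h₁ h₂ h₁₂ hn hd0 hd) fun x y hxy => ?_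
  have hzero (p : Fin (n + 1) × Fin (n + 1)) (hp0 : p ≠ (0, 0)) (hp1 : p ≠ (e₁, e₁)) :
      x p.1 * y p.2 = 0 :=
    eq_zero_of_entangledMatrix_mulVec_eq_zero h₁ h₂ hn hd0 hd hxy hp0 hp1
  have hleft : x e₁ * y e₁ + r * (x 0 * y 0) = 0 :=
    add_mul_eq_zero_of_entangledMatrix_mulVec_eq_zero h₁ h₁₂ hxy
  have hcross : x 0 * y e₁ = 0 := hzero (0, e₁) (by simp [h₁]) (by simp [h₁.symm])
  have h00 : x 0 * y 0 = 0 := by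
    refine pow_eq_zero_iff two_ne_zero |>.mp
      ((mul_eq_zero.mp ?_).resolve_left (Complex.ofReal_ne_zero.mpr hr))
    linear_combination (x 0 * y 0) * hleft - (x e₁ * y 0) * hcross
  have h11 : x e₁ * y e₁ = 0 := by rwa [h00, mul_zero, add_zero] at hleft
  by_contra! hne
  obtain ⟨i, hi⟩ := Function.ne_iff.mp hne.1
  obtain ⟨j, hj⟩ := Function.ne_iff.mp hne.2
  refine mul_ne_zero hi hj (show x (i, j).1 * y (i, j).2 = 0 from ?_)
  rcases eq_or_ne (i, j) (0, 0) with h | hp0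
  · rwa [h]
  rcases eq_or_ne (i, j) (e₁, e₁) with h | hp1
  · rwa [h]
  exact hzero _ hp0 hp1

end EntangledMatrix

section HermitianBasis

/-- The complex number `1 / √2`. -/
noncomputable def invSqrtTwo : ℂ := ((1 / √2 : ℝ) : ℂ)

theorem invSqrtTwo_mul_self : invSqrtTwo * invSqrtTwo = 1 / 2 := by
  rw [invSqrtTwo, ← Complex.ofReal_mul, div_mul_div_comm, Real.mul_self_sqrt zero_le_two, one_mul,
    Complex.ofReal_div, Complex.ofReal_one, Complex.ofReal_ofNat]

theorem conj_invSqrtTwo : star invSqrtTwo = invSqrtTwo := Complex.conj_ofReal _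

variable {ι : Type*} [DecidableEq ι] (p q : ι)

/-- The normalized Hermitian matrix `(E_pp - E_qq) / √2`. -/
noncomputable def diffBasis : Matrix ι ι ℂ :=
  invSqrtTwo • Matrix.diagonal fun i => (differenceVec p q i : ℂ)

/-- The normalized Hermitian matrix `(E_pq + E_qp) / √2`. -/
noncomputable def symmBasis : Matrix ι ι ℂ := invSqrtTwo • coupling p q

/-- The normalized Hermitian matrix `i (E_qp - E_pq) / √2`. -/
noncomputable def skewBasis : Matrix ι ι ℂ :=
  (invSqrtTwo * Complex.I) • (Matrix.single q p 1 - Matrix.single p q 1)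

theorem isHermitian_diffBasis : (diffBasis p q).IsHermitian :=
  (isHermitian_diagonal_ofReal _).smul conj_invSqrtTwo

theorem isHermitian_symmBasis : (symmBasis p q).IsHermitian :=
  (isHermitian_coupling p q).smul conj_invSqrtTwo

theorem isHermitian_skewBasis : (skewBasis p q).IsHermitian := by
  rw [Matrix.IsHermitian, skewBasis, Matrix.conjTranspose_smul, Matrix.conjTranspose_sub,
    Matrix.conjTranspose_single, Matrix.conjTranspose_single, star_mul', conj_invSqrtTwo, star_one,
    Complex.star_def, Complex.conj_I]
  module

theorem isSymm_symmBasis : (symmBasis p q).IsSymm := by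
  rw [Matrix.IsSymm, symmBasis, coupling, Matrix.transpose_smul, Matrix.transpose_add,
    Matrix.transpose_single, Matrix.transpose_single, add_comm]

theorem diffBasis_kronecker_diffBasis :
    diffBasis p q ⊗ₖ diffBasis p q = (1 / 2 : ℂ) • Matrix.diagonal fun s =>
      ((differenceVec p q s.1 * differenceVec p q s.2 : ℝ) : ℂ) := by
  simp only [diffBasis, Matrix.smul_kronecker, Matrix.kronecker_smul, smul_smul,
    invSqrtTwo_mul_self, Matrix.diagonal_kronecker_diagonal, Complex.ofReal_mul]

theorem symmBasis_kronecker_symmBasis :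
    symmBasis p q ⊗ₖ symmBasis p q = (1 / 2 : ℂ) • (coupling p q ⊗ₖ coupling p q) := by
  rw [symmBasis, Matrix.smul_kronecker, Matrix.kronecker_smul, smul_smul, invSqrtTwo_mul_self]

theorem skewBasis_kronecker_skewBasis :
    skewBasis p q ⊗ₖ skewBasis p q = (-1 / 2 : ℂ) •
      ((Matrix.single q p (1 : ℂ) - Matrix.single p q 1) ⊗ₖ
        (Matrix.single q p (1 : ℂ) - Matrix.single p q 1)) := by
  rw [skewBasis, Matrix.smul_kronecker, Matrix.kronecker_smul, smul_smul, mul_mul_mul_comm,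
    invSqrtTwo_mul_self, Complex.I_mul_I, one_div_mul_eq_div]

theorem symmBasis_kronecker_sub_skewBasis_kronecker :
    symmBasis p q ⊗ₖ symmBasis p q - skewBasis p q ⊗ₖ skewBasis p q = coupling (p, p) (q, q) := by
  rw [symmBasis_kronecker_symmBasis, skewBasis_kronecker_skewBasis]
  simp only [coupling, Matrix.add_kronecker, Matrix.kronecker_add, sub_kronecker, kronecker_sub,
    Matrix.single_kronecker_single, mul_one]
  module

theorem symmBasis_kronecker_add_skewBasis_kronecker :
    symmBasis p q ⊗ₖ symmBasis p q + skewBasis p q ⊗ₖ skewBasis p q = coupling (q, p) (p, q) := by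
  rw [symmBasis_kronecker_symmBasis, skewBasis_kronecker_skewBasis]
  simp only [coupling, Matrix.add_kronecker, Matrix.kronecker_add, sub_kronecker, kronecker_sub,
    Matrix.single_kronecker_single, mul_one]
  module

theorem isDiag_diffBasis : (diffBasis p q).IsDiag := (Matrix.isDiag_diagonal _).smul _

variable [Fintype ι] {p q}

theorem trace_diagonal_mul_diffBasis (d : ι → ℂ) (p q : ι) :
    (Matrix.diagonal d * diffBasis p q).trace = invSqrtTwo * (d p - d q) := by
  simp only [diffBasis, differenceVec, Matrix.mul_smul, Matrix.diagonal_mul_diagonal,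
    Matrix.trace_smul, Matrix.trace_diagonal, Pi.sub_apply, Pi.single_apply, Complex.ofReal_sub,
    apply_ite Complex.ofReal, Complex.ofReal_one, Complex.ofReal_zero, mul_sub, mul_ite, mul_one,
    mul_zero, Finset.sum_sub_distrib, Finset.sum_ite_eq', Finset.mem_univ, if_true, smul_eq_mul]

theorem trace_mul_symmBasis (M : Matrix ι ι ℂ) (p q : ι) :
    (M * symmBasis p q).trace = invSqrtTwo * (M q p + M p q) := by
  simp only [symmBasis, coupling, Matrix.mul_smul, Matrix.mul_add, Matrix.trace_smul,
    Matrix.trace_add, Matrix.trace_mul_single, smul_eq_mul, MulOpposite.op_one, one_smul]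

theorem trace_mul_skewBasis (M : Matrix ι ι ℂ) (p q : ι) :
    (M * skewBasis p q).trace = invSqrtTwo * Complex.I * (M p q - M q p) := by
  simp only [skewBasis, Matrix.mul_smul, Matrix.mul_sub, Matrix.trace_smul, Matrix.trace_sub,
    Matrix.trace_mul_single, smul_eq_mul, MulOpposite.op_one, one_smul]

theorem trace_mul_symmBasis_of_isDiag {M : Matrix ι ι ℂ} (hM : M.IsDiag) (hpq : p ≠ q) :
    (M * symmBasis p q).trace = 0 := by
  rw [trace_mul_symmBasis, hM hpq, hM hpq.symm, add_zero, mul_zero]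

theorem trace_mul_skewBasis_of_isSymm {M : Matrix ι ι ℂ} (hM : M.IsSymm) (p q : ι) :
    (M * skewBasis p q).trace = 0 := by
  rw [trace_mul_skewBasis, hM.apply p q, sub_self, mul_zero]

theorem trace_diffBasis_mul_self (hpq : p ≠ q) : (diffBasis p q * diffBasis p q).trace = 1 := by
  have hdiff : (differenceVec p q p : ℂ) - differenceVec p q q = 2 := by
    norm_num [differenceVec, hpq, hpq.symm]
  nth_rw 1 [diffBasis]
  rw [Matrix.smul_mul, Matrix.trace_smul, trace_diagonal_mul_diffBasis, hdiff, smul_eq_mul,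
    ← mul_assoc, invSqrtTwo_mul_self, one_div_mul_cancel two_ne_zero]

theorem trace_symmBasis_mul_self (hpq : p ≠ q) : (symmBasis p q * symmBasis p q).trace = 1 := by
  have hqp : symmBasis p q q p = invSqrtTwo := by simp [symmBasis, coupling, hpq]
  rw [trace_mul_symmBasis, (isSymm_symmBasis p q).apply q p, hqp, ← two_mul, mul_left_comm,
    invSqrtTwo_mul_self, mul_one_div_cancel two_ne_zero]

theorem trace_skewBasis_mul_self (hpq : p ≠ q) : (skewBasis p q * skewBasis p q).trace = 1 := by
  have hpq' : skewBasis p q p q = -(invSqrtTwo * Complex.I) := by simp [skewBasis, hpq]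
  have hqp' : skewBasis p q q p = invSqrtTwo * Complex.I := by simp [skewBasis, hpq]
  rw [trace_mul_skewBasis, hpq', hqp']
  linear_combination (-2 * invSqrtTwo * invSqrtTwo) * Complex.I_mul_I + 2 * invSqrtTwo_mul_self

theorem trace_symmBasis_mul_symmBasis {q' : ι} (p : ι) (hq : q ≠ q') :
    (symmBasis p q * symmBasis p q').trace = 0 := by
  have hzero : symmBasis p q p q' = 0 := by
    simp only [symmBasis, coupling, Matrix.smul_apply, Matrix.add_apply, Matrix.single_apply,
      smul_eq_mul]
    grind
  rw [trace_mul_symmBasis, (isSymm_symmBasis p q).apply p q', hzero, add_zero, mul_zero]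

theorem trace_skewBasis_mul_skewBasis {q' : ι} (p : ι) (hq : q ≠ q') :
    (skewBasis p q * skewBasis p q').trace = 0 := by
  rw [trace_mul_skewBasis]
  simp only [skewBasis, Matrix.smul_apply, Matrix.sub_apply, Matrix.single_apply, smul_eq_mul]
  grind

end HermitianBasis

theorem isOrthonormalFamily_of_lt {k n : ℕ} {γ : Fin n → Matrix (Fin k) (Fin k) ℂ}
    (hγ : ∀ i, (γ i).IsHermitian) (h1 : ∀ i, (γ i * γ i).trace = 1)
    (h0 : ∀ i j, i < j → (γ i * γ j).trace = 0) : IsOrthonormalFamily γ := by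
  intro i j
  rw [(hγ j).eq]
  rcases lt_trichotomy i j with h | rfl | h
  · rw [h0 i j h, if_neg h.ne]
  · rw [h1, if_pos rfl]
  · rw [Matrix.trace_mul_comm, h0 j i h, if_neg h.ne']

theorem IsOrthonormalFamily.of_eq_or_eq_neg {k n : ℕ} {γ δ : Fin n → Matrix (Fin k) (Fin k) ℂ}
    (hγ : IsOrthonormalFamily γ) (h : ∀ i, δ i = γ i ∨ δ i = -γ i) : IsOrthonormalFamily δ := by
  intro i j
  rcases eq_or_ne i j with rfl | hij
  · rcases h i with hi | hi <;> simp [hi, hγ i i]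
  · rcases h i with hi | hi <;> rcases h j with hj | hj <;> simp [hi, hj, hγ i j, hij]

section EntangledSchmidt

/-- The left Schmidt vectors of `entangledMatrix`. -/
noncomputable def entangledLeft {n : ℕ} (e₁ e₂ : Fin (n + 1)) :
    Fin 7 → Matrix (Fin (n + 1)) (Fin (n + 1)) ℂ :=
  ![normalizedOne n, tracelessDiag n, diffBasis e₁ e₂, symmBasis 0 e₁, skewBasis 0 e₁,
    symmBasis 0 e₂, skewBasis 0 e₂]

/-- The right Schmidt vectors of `entangledMatrix`. -/
noncomputable def entangledRight {n : ℕ} (e₁ e₂ : Fin (n + 1)) :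
    Fin 7 → Matrix (Fin (n + 1)) (Fin (n + 1)) ℂ :=
  ![normalizedOne n, -tracelessDiag n, diffBasis e₁ e₂, symmBasis 0 e₁, -skewBasis 0 e₁,
    symmBasis 0 e₂, skewBasis 0 e₂]

/-- The Schmidt coefficients of `entangledMatrix`. -/
def entangledCoeff (n : ℕ) (d r : ℝ) : Fin 7 → ℝ :=
  ![n + 1, d * (n ^ 2 + n), 2 * d, r, r, r, r]

variable {n : ℕ} {e₁ e₂ : Fin (n + 1)} {d r : ℝ}

theorem entangledCoeff_pos (hn : 1 ≤ n) (hd : 0 < d) (hr : 0 < r) (i : Fin 7) :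
    0 < entangledCoeff n d r i := by
  have : (0 : ℝ) < n := Nat.cast_pos.mpr hn
  have hsecond : 0 < d * ((n : ℝ) ^ 2 + n) := by positivity
  fin_cases i
  exacts [n.cast_add_one_pos, hsecond, mul_pos two_pos hd, hr, hr, hr, hr]

theorem isHermitian_entangledLeft (i : Fin 7) : (entangledLeft e₁ e₂ i).IsHermitian := by
  fin_cases i
  exacts [isHermitian_normalizedOne n, isHermitian_tracelessDiag n, isHermitian_diffBasis _ _,
    isHermitian_symmBasis _ _, isHermitian_skewBasis _ _, isHermitian_symmBasis _ _,
    isHermitian_skewBasis _ _]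

theorem entangledRight_eq_or_eq_neg (i : Fin 7) : entangledRight e₁ e₂ i = entangledLeft e₁ e₂ i ∨
    entangledRight e₁ e₂ i = -entangledLeft e₁ e₂ i := by
  fin_cases i
  exacts [.inl rfl, .inr rfl, .inl rfl, .inl rfl, .inr rfl, .inl rfl, .inl rfl]

theorem isHermitian_entangledRight (i : Fin 7) : (entangledRight e₁ e₂ i).IsHermitian := by
  rcases entangledRight_eq_or_eq_neg (e₁ := e₁) (e₂ := e₂) i with h | h <;> rw [h]
  exacts [isHermitian_entangledLeft i, (isHermitian_entangledLeft i).neg]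

theorem isDiag_entangledLeft {i : Fin 7} (hi : i < 3) : (entangledLeft e₁ e₂ i).IsDiag := by
  obtain rfl | rfl | rfl : i = 0 ∨ i = 1 ∨ i = 2 := by omega
  exacts [Matrix.isDiag_diagonal _, Matrix.isDiag_diagonal _, isDiag_diffBasis _ _]

theorem isSymm_entangledLeft {i : Fin 7} (h₄ : i ≠ 4) (h₆ : i ≠ 6) :
    (entangledLeft e₁ e₂ i).IsSymm := by
  rcases lt_or_ge i 3 with hi | hi
  · exact (isDiag_entangledLeft hi).isSymm
  · obtain rfl | rfl : i = 3 ∨ i = 5 := by omega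
    exacts [isSymm_symmBasis _ _, isSymm_symmBasis _ _]

theorem trace_entangledLeft_mul_self (h₁ : e₁ ≠ 0) (h₂ : e₂ ≠ 0) (h₁₂ : e₁ ≠ e₂) (hn : 1 ≤ n)
    (i : Fin 7) : (entangledLeft e₁ e₂ i * entangledLeft e₁ e₂ i).trace = 1 := by
  fin_cases i
  exacts [trace_normalizedOne_mul_self n, trace_tracelessDiag_mul_self hn,
    trace_diffBasis_mul_self h₁₂, trace_symmBasis_mul_self h₁.symm,
    trace_skewBasis_mul_self h₁.symm, trace_symmBasis_mul_self h₂.symm,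
    trace_skewBasis_mul_self h₂.symm]

theorem trace_normalizedOne_mul_diffBasis (e₁ e₂ : Fin (n + 1)) :
    (normalizedOne n * diffBasis e₁ e₂).trace = 0 := by
  rw [normalizedOne, trace_diagonal_mul_diffBasis, sub_self, mul_zero]

theorem trace_tracelessDiag_mul_diffBasis (h₁ : e₁ ≠ 0) (h₂ : e₂ ≠ 0) :
    (tracelessDiag n * diffBasis e₁ e₂).trace = 0 := by
  rw [tracelessDiag, trace_diagonal_mul_diffBasis, if_neg h₁, if_neg h₂, sub_self, mul_zero]

theorem trace_entangledLeft_mul_of_lt (h₁ : e₁ ≠ 0) (h₂ : e₂ ≠ 0) (h₁₂ : e₁ ≠ e₂) (i j : Fin 7)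
    (hij : i < j) : (entangledLeft e₁ e₂ i * entangledLeft e₁ e₂ j).trace = 0 := by
  fin_cases j
  · exact absurd hij (Fin.not_lt_zero i)
  · obtain rfl : i = 0 := Fin.lt_one_iff i |>.mp hij
    exact trace_normalizedOne_mul_tracelessDiag n
  · obtain rfl | rfl : i = 0 ∨ i = 1 := by
      change i < 2 at hij
      omega
    exacts [trace_normalizedOne_mul_diffBasis e₁ e₂, trace_tracelessDiag_mul_diffBasis h₁ h₂]
  · exact trace_mul_symmBasis_of_isDiag (isDiag_entangledLeft hij) h₁.symm
  · exact trace_mul_skewBasis_of_isSymm (isSymm_entangledLeft hij.ne (by omega)) 0 e₁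
  · rcases lt_or_ge i 3 with hi | hi
    · exact trace_mul_symmBasis_of_isDiag (isDiag_entangledLeft hi) h₂.symm
    obtain rfl | rfl : i = 3 ∨ i = 4 := by
      change i < 5 at hij
      omega
    · exact trace_symmBasis_mul_symmBasis 0 h₁₂
    · exact (Matrix.trace_mul_comm _ _).trans
        (trace_mul_skewBasis_of_isSymm (isSymm_symmBasis 0 e₂) 0 e₁)
  · rcases eq_or_ne i 4 with rfl | h₄
    · exact trace_skewBasis_mul_skewBasis 0 h₁₂
    · exact trace_mul_skewBasis_of_isSymm (isSymm_entangledLeft h₄ hij.ne) 0 e₂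

theorem isOrthonormalFamily_entangledLeft (h₁ : e₁ ≠ 0) (h₂ : e₂ ≠ 0) (h₁₂ : e₁ ≠ e₂)
    (hn : 1 ≤ n) : IsOrthonormalFamily (entangledLeft e₁ e₂) :=
  isOrthonormalFamily_of_lt isHermitian_entangledLeft
    (trace_entangledLeft_mul_self h₁ h₂ h₁₂ hn) (trace_entangledLeft_mul_of_lt h₁ h₂ h₁₂)

theorem diagonal_entangledDiag (hn : 1 ≤ n) (e₁ e₂ : Fin (n + 1)) (d : ℝ) :
    (Matrix.diagonal fun p => (entangledDiag e₁ e₂ d p : ℂ)) =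
      diagFamily n (n + 1) (d * (n ^ 2 + n)) +
        ((2 * d : ℝ) : ℂ) • (diffBasis e₁ e₂ ⊗ₖ diffBasis e₁ e₂) := by
  have : (0 : ℝ) < n := Nat.cast_pos.mpr hn
  rw [diagFamily_eq_diagonal, diffBasis_kronecker_diffBasis, smul_smul, ← Matrix.diagonal_smul,
    Matrix.diagonal_add]
  congr 1
  ext p
  have hfirst : ((n : ℝ) + 1) * (1 / (n + 1)) = 1 := mul_one_div_cancel n.cast_add_one_ne_zero
  have hsecond : tracelessVec n p.1 * tracelessVec n p.2 / ((n : ℝ) ^ 2 + n) * (d * (n ^ 2 + n)) =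
      d * (tracelessVec n p.1 * tracelessVec n p.2) := by
    field_simp
  rw [entangledDiag, hfirst, hsecond, Pi.smul_apply, smul_eq_mul]
  push_cast
  ring

theorem entangledMatrix_eq_sum (hn : 1 ≤ n) : entangledMatrix e₁ e₂ d r = ∑ i,
    (entangledCoeff n d r i : ℂ) • (entangledLeft e₁ e₂ i ⊗ₖ entangledRight e₁ e₂ i) := by
  have hneg : skewBasis 0 e₁ ⊗ₖ (-skewBasis 0 e₁) = -(skewBasis 0 e₁ ⊗ₖ skewBasis 0 e₁) := by
    rw [← neg_one_smul ℂ, Matrix.kronecker_smul, neg_one_smul]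
  rw [entangledMatrix, diagonal_entangledDiag hn, diagFamily,
    ← symmBasis_kronecker_sub_skewBasis_kronecker, ← symmBasis_kronecker_add_skewBasis_kronecker,
    sub_eq_add_neg, ← hneg, Fin.sum_univ_seven]
  simp only [entangledCoeff, entangledLeft, entangledRight, Matrix.cons_val, smul_add]
  abel

theorem isHermitianSchmidtDecomposition_entangledMatrix (h₁ : e₁ ≠ 0) (h₂ : e₂ ≠ 0)
    (h₁₂ : e₁ ≠ e₂) (hn : 1 ≤ n) (hr : 0 < r) (hd : 0 < d) :
    IsHermitianSchmidtDecomposition (entangledMatrix e₁ e₂ d r) (entangledCoeff n d r)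
      (entangledLeft e₁ e₂) (entangledRight e₁ e₂) where
  lam_pos := entangledCoeff_pos hn hd hr
  hermitian_left := isHermitian_entangledLeft
  hermitian_right := isHermitian_entangledRight
  orthonormal_left := isOrthonormalFamily_entangledLeft h₁ h₂ h₁₂ hn
  orthonormal_right :=
    (isOrthonormalFamily_entangledLeft h₁ h₂ h₁₂ hn).of_eq_or_eq_neg entangledRight_eq_or_eq_neg
  eq_sum := entangledMatrix_eq_sum hn

theorem antitone_entangledCoeff (hsecond : d * (n ^ 2 + n) ≤ n + 1)
    (hthird : 2 * d ≤ d * (n ^ 2 + n)) (hrd : r ≤ 2 * d) : Antitone (entangledCoeff n d r) := by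
  rw [Fin.antitone_iff_succ_le]
  intro i
  fin_cases i
  exacts [hsecond, hthird, hrd, le_rfl, le_rfl, le_rfl]

theorem sum_entangledCoeff_succ (n : ℕ) (d r : ℝ) :
    ∑ i : Fin 6, entangledCoeff n d r i.succ = d * (n ^ 2 + n) + 2 * d + 4 * r := by
  rw [Fin.sum_univ_six]
  change d * ((n : ℝ) ^ 2 + n) + 2 * d + r + r + r + r = _
  ring

theorem exists_entangledCoeff_antitone_sum_le (hn : 2 ≤ n) :
    ∃ d r : ℝ, 0 < d ∧ 0 < r ∧ d * n ^ 2 = 1 - r ^ 2 ∧ Antitone (entangledCoeff n d r) ∧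
      ∑ i : Fin 6, entangledCoeff n d r i.succ ≤ 1 + 4 / n := by
  have hn' : (2 : ℝ) ≤ n := Nat.ofNat_le_cast.mpr hn
  have hn0 : (0 : ℝ) < n := by linarith
  obtain ⟨s, hs0, hs2, hsn⟩ : ∃ s : ℝ, 0 < s ∧ s ≤ 1 / 2 ∧ s * n = 1 :=
    ⟨1 / n, one_div_pos.mpr hn0, one_div_le_one_div_of_le two_pos hn', one_div_mul_cancel hn0.ne'⟩
  have hs_inv : 4 / (n : ℝ) = 4 * s := by rw [div_eq_iff hn0.ne', mul_assoc, hsn, mul_one]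
  -- `d (n² + n)` tends to `1`, while all later coefficients are `O(n⁻²)`.
  obtain ⟨r, hr⟩ : ∃ r : ℝ, r = s ^ 2 := ⟨_, rfl⟩
  obtain ⟨d, hd⟩ : ∃ d : ℝ, d = (1 - r ^ 2) * r := ⟨_, rfl⟩
  have hr0 : 0 < r := hr ▸ pow_pos hs0 2
  have hrs : r ≤ s / 2 := by nlinarith
  have hr2 : r ^ 2 ≤ 1 / 2 := by nlinarith
  have hrn : r * n = s := by rw [hr, sq, mul_assoc, hsn, mul_one]
  have hd0 : 0 < d := hd ▸ mul_pos (by linarith) hr0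
  have hdr : d ≤ r := by nlinarith [sq_nonneg r]
  have hrd : r ≤ 2 * d := by nlinarith
  have hdn : d * n ≤ s := hrn ▸ mul_le_mul_of_nonneg_right hdr hn0.le
  have hdn2 : d * n ^ 2 = 1 - r ^ 2 := by
    rw [hd, sq (n : ℝ), mul_assoc, ← mul_assoc r, hrn, hsn, mul_one]
  have hdn1 : d * 2 ≤ d * n := mul_le_mul_of_nonneg_left hn' hd0.le
  refine ⟨d, r, hd0, hr0, hdn2, antitone_entangledCoeff ?_ ?_ hrd, ?_⟩
  · linarith [sq_nonneg r]
  · linarith [sq_nonneg r]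
  · rw [sum_entangledCoeff_succ, hs_inv]
    linarith [sq_nonneg r]

theorem exists_entangled_of_lt_one {l : ℝ} (hl0 : 0 < l) (hl : l < 1) :
    ∃ (k m n : ℕ) (A : BipartiteMatrix k m) (lam : Fin (n + 1) → ℝ)
      (γ : Fin (n + 1) → Matrix (Fin k) (Fin k) ℂ)
      (δ : Fin (n + 1) → Matrix (Fin m) (Fin m) ℂ) (μ : ℝ),
      IsWeakIrreducible A ∧ IsPPT A ∧
      IsHermitianSchmidtDecomposition A lam γ δ ∧ Antitone lam ∧
      IsLeastPositiveEigenvalue (γ 0 ⊗ₖ δ 0) μ ∧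
      l ≤ lam 0 * μ / ∑ i : Fin n, lam i.succ ∧
      ¬ IsSeparableMatrix A := by
  have hl1 : 0 < 1 - l := sub_pos.mpr hl
  obtain ⟨N, hN⟩ := exists_nat_ge (4 / (1 - l))
  obtain ⟨n, hn2, hn⟩ : ∃ n : ℕ, 2 ≤ n ∧ 4 / (1 - l) ≤ n :=
    ⟨max N 2, le_max_right _ _, hN.trans (Nat.cast_le.mpr (le_max_left _ _))⟩
  have hn1 : 1 ≤ n := one_le_two.trans hn2
  obtain ⟨d, r, hd0, hr0, hd, hanti, hsum⟩ := exists_entangledCoeff_antitone_sum_le hn2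
  let e₁ : Fin (n + 1) := ⟨1, by omega⟩
  let e₂ : Fin (n + 1) := ⟨2, by omega⟩
  have h₁ : e₁ ≠ 0 := Fin.ne_of_val_ne one_ne_zero
  have h₂ : e₂ ≠ 0 := Fin.ne_of_val_ne two_ne_zero
  have h₁₂ : e₁ ≠ e₂ := Fin.ne_of_val_ne (by decide : 1 ≠ 2)
  refine ⟨n + 1, n + 1, 6, entangledMatrix e₁ e₂ d r, entangledCoeff n d r, entangledLeft e₁ e₂,
    entangledRight e₁ e₂, 1 / ((n : ℝ) + 1),
    isWeakIrreducible_entangledMatrix h₁ h₂ h₁₂ hn2 hr0.ne' hd0 hd,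
    isPPT_entangledMatrix h₁ h₂ h₁₂ hn2 hd0 hd,
    isHermitianSchmidtDecomposition_entangledMatrix h₁ h₂ h₁₂ hn1 hr0 hd0, hanti,
    isLeastPositiveEigenvalue_normalizedOne n, ?_,
    not_isSeparableMatrix_entangledMatrix h₁ h₂ h₁₂ hr0.ne' hd0 hd⟩
  have hfirst : entangledCoeff n d r 0 * (1 / ((n : ℝ) + 1)) = 1 :=
    mul_one_div_cancel n.cast_add_one_ne_zero
  have hsum_le : ∑ i : Fin 6, entangledCoeff n d r i.succ ≤ 1 + (1 - l) :=
    hsum.trans (add_le_add_right ((div_le_comm₀ hl1 (Nat.cast_pos.mpr hn1)).mp hn) 1)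
  have hsum_pos : 0 < ∑ i : Fin 6, entangledCoeff n d r i.succ :=
    Finset.sum_pos (fun i _ => entangledCoeff_pos hn1 hd0 hr0 i.succ) Finset.univ_nonempty
  rw [hfirst, le_div_iff₀ hsum_pos]
  nlinarith

end EntangledSchmidt

theorem mainTheorem7 :
    -- the inequality (the index `0` plays the role of the first, largest coefficient)
    (∀ (k m n : ℕ) (A : BipartiteMatrix k m) (lam : Fin (n + 1) → ℝ)
        (γ : Fin (n + 1) → Matrix (Fin k) (Fin k) ℂ)
        (δ : Fin (n + 1) → Matrix (Fin m) (Fin m) ℂ) (μ : ℝ),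
        IsWeakIrreducible A → IsPPT A →
        IsHermitianSchmidtDecomposition A lam γ δ → Antitone lam →
        IsLeastPositiveEigenvalue (γ 0 ⊗ₖ δ 0) μ →
        ∑ i : Fin n, lam i.succ ≤ lam 0 * μ →
        IsSeparableMatrix A) ∧
    -- the constant `1` cannot be replaced by a smaller one
    (∀ l : ℝ, 0 < l → l < 1 →
      ∃ (k m n : ℕ) (A : BipartiteMatrix k m) (lam : Fin (n + 1) → ℝ)
        (γ : Fin (n + 1) → Matrix (Fin k) (Fin k) ℂ)
        (δ : Fin (n + 1) → Matrix (Fin m) (Fin m) ℂ) (μ : ℝ),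
        IsWeakIrreducible A ∧ IsPPT A ∧
        IsHermitianSchmidtDecomposition A lam γ δ ∧ Antitone lam ∧
        IsLeastPositiveEigenvalue (γ 0 ⊗ₖ δ 0) μ ∧
        l ≤ lam 0 * μ / ∑ i : Fin n, lam i.succ ∧
        ¬ IsSeparableMatrix A) ∧
    -- the explicit family whose separability thresholds approach `1`
    (∀ n : ℕ, 1 ≤ n →
      IsLeastPositiveEigenvalue (normalizedOne n ⊗ₖ normalizedOne n) (1 / ((n : ℝ) + 1)) ∧
      ∀ lam₁ lam₂ : ℝ, 0 < lam₁ → 0 < lam₂ →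
        IsHermitianSchmidtDecomposition (diagFamily n lam₁ lam₂) ![lam₁, lam₂]
          ![normalizedOne n, tracelessDiag n] ![normalizedOne n, -tracelessDiag n] ∧
        (IsSeparableMatrix (diagFamily n lam₁ lam₂) ↔
          (n : ℝ) ^ 2 / ((n : ℝ) ^ 2 + n) ≤ lam₁ * (1 / ((n : ℝ) + 1)) / lam₂)) ∧
    (∀ l : ℝ, 0 < l → l < 1 →
      ∃ n : ℕ, 1 ≤ n ∧ l < (n : ℝ) ^ 2 / ((n : ℝ) ^ 2 + n)) := by
  refine ⟨fun k m n A lam γ δ μ hw hA h hmono hμ hle =>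
      hw.isSeparableMatrix_of_sum_le hA h hmono hμ hle,
    fun l hl0 hl1 => exists_entangled_of_lt_one hl0 hl1,
    fun n hn => ⟨isLeastPositiveEigenvalue_normalizedOne n, fun lam₁ lam₂ h₁ h₂ =>
      ⟨isHermitianSchmidtDecomposition_diagFamily hn h₁ h₂,
        isSeparableMatrix_diagFamily_iff hn h₂⟩⟩,
    fun l _ hl1 => exists_lt_sq_div l hl1⟩
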